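/- For a positive integer $m$ write $[m]=\{1,\dots,m\}$, and let $\binom{[n]}{k}$ be the family of $k$-element subsets of $[n]$. A family $\mathcal F$ of sets is $t$-intersecting if $|F\cap F'|\ge t$ for all $F,F'\in\mathcal F$; families $\mathcal A,\mathcal B$ are $s$-cross-intersecting if $|A\cap B|\ge s$ for all $A\in\mathcal A$, $B\in\mathcal B$. Let $k>s>t\ge 1$ be integers with $k\ge 2s-t$. For $0\le i<s-t$ put $$\mathcal M_i=\{M\subseteq[k]: |M|\ge s,\ |M\cap[t+2i]|\ge t+i\}\cup\{M\subseteq[k]: |M|\ge k-s+t\},$$ $$\mathcal A_i=\Big\{A\in\tbinom{[n]}{k}: A\cap[k]\in\mathcal M_i\Big\},\qquad \mathcal B_i=\{[k]\},$$ and for $i=s-t$ put $$\mathcal A_{s-t}=\Big\{A\in\tbinom{[n]}{k}: |A\cap[2s-t]|\ge s\Big\},\qquad \mathcal B_{s-t}=\Big\{B\in\tbinom{[n]}{k}: [2s-t]\subseteq B\Big\}.$$ Then there is $n_0=n_0(s,t,k)$ such that the following holds for all $n\ge n_0$. Let $(\mathcal A,\mathcal B)$ range over the pairs of nonempty $t$-intersecting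 families $\mathcal A,\mathcal B\subseteq\binom{[n]}{k}$ that are $s$-cross-intersecting. Then $$\max_{\mathcal A,\mathcal B}\big(|\mathcal A|+|\mathcal B|\big)=\max_{0\le i\le s-t}\big(|\mathcal A_i|+|\mathcal B_i|\big).$$ Moreover, unless $k=2s$ and $t=1$, the pairs $(\mathcal A,\mathcal B)$ attaining the maximum on the left are exactly those for which, for some $0\le i\le s-t$ attaining the maximum on the right, a single permutation of $[n]$ carries $(\mathcal A,\mathcal B)$ to $(\mathcal A_i,\mathcal B_i)$ or to $(\mathcal B_i,\mathcal A_i)$. -/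

import Mathlib

/-- The initial segment `[m]` of the ground set `[n]`; the ground set is `Fin n`, so that the
element `j` of `[n]` is the element of `Fin n` with value `j - 1`. -/
def initSeg (n m : ℕ) : Finset (Fin n) :=
  Finset.univ.filter (fun x => x.val < m)

/-- Any two (not necessarily distinct) members share at least `t` elements. -/
def TIntersecting {n : ℕ} (t : ℕ) (F : Finset (Finset (Fin n))) : Prop :=
  ∀ A ∈ F, ∀ B ∈ F, t ≤ (A ∩ B).card

/-- Any member of `F` and any member of `G` share at least `s` elements. -/
def SCrossIntersecting {n : ℕ} (s : ℕ) (F G : Finset (Finset (Fin n))) : Prop :=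
  ∀ A ∈ F, ∀ B ∈ G, s ≤ (A ∩ B).card

/-- Pairs of nonempty `t`-intersecting families of `k`-subsets of `[n]` that are
`s`-cross-intersecting. -/
structure AdmissiblePair {n : ℕ} (k s t : ℕ) (F G : Finset (Finset (Fin n))) : Prop where
  left_uniform : ∀ A ∈ F, A.card = k
  right_uniform : ∀ B ∈ G, B.card = k
  left_nonempty : F.Nonempty
  right_nonempty : G.Nonempty
  left_intersecting : TIntersecting t F
  right_intersecting : TIntersecting t G
  cross_intersecting : SCrossIntersecting s F G

/-- The family `M_i(k,s,t)` of subsets of `[k]`, viewed inside `[n]`. -/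
def familyM (n k s t i : ℕ) : Finset (Finset (Fin n)) :=
  (initSeg n k).powerset.filter
      (fun A => s ≤ A.card ∧ t + i ≤ (A ∩ initSeg n (t + 2 * i)).card) ∪
    (initSeg n k).powerset.filter (fun A => k - s + t ≤ A.card)

/-- The family `A_i`, for `0 ≤ i ≤ s - t`. -/
def familyA (n k s t i : ℕ) : Finset (Finset (Fin n)) :=
  if i < s - t then
    (Finset.powersetCard k Finset.univ).filter (fun A => A ∩ initSeg n k ∈ familyM n k s t i)
  else
    (Finset.powersetCard k Finset.univ).filter (fun A => s ≤ (A ∩ initSeg n (2 * s - t)).card)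

/-- The family `B_i`, for `0 ≤ i ≤ s - t`. -/
def familyB (n k s t i : ℕ) : Finset (Finset (Fin n)) :=
  if i < s - t then
    {initSeg n k}
  else
    (Finset.powersetCard k Finset.univ).filter (fun B => initSeg n (2 * s - t) ⊆ B)

/-- The maximum of `|A_i| + |B_i|` over `0 ≤ i ≤ s - t`. -/
def maxConstruction (n k s t : ℕ) : ℕ :=
  (Finset.range (s - t + 1)).sup
    (fun i => (familyA n k s t i).card + (familyB n k s t i).card)

/-- The image of a family under a permutation of the ground set. -/
def permFamily {n : ℕ} (σ : Equiv.Perm (Fin n)) (F : Finset (Finset (Fin n))) :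
    Finset (Finset (Fin n)) :=
  F.image (fun A => A.image σ)

/-- The unordered pairs `{F, G}` and `{F', G'}` are isomorphic: one permutation of the ground set
carries the first to the second. -/
def PairIsomorphic {n : ℕ} (F G F' G' : Finset (Finset (Fin n))) : Prop :=
  ∃ σ : Equiv.Perm (Fin n),
    (permFamily σ F = F' ∧ permFamily σ G = G') ∨ (permFamily σ F = G' ∧ permFamily σ G = F')

/-! For large $n$ the pair is governed by the $s$-sets lying in many members. Call an $s$-set heavy
for $F$ if more than $k\,n^{k-s-1}$ members of $F$ contain it. Fewer than that many can also meet a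
given $k$-set $Z$ outside $S$, so some member $A \supseteq S$ has $A \cap Z \subseteq S$. Heavy sets
therefore inherit intersection bounds (`le_card_inter_of_heavy`): the heavy sets $T$ of $F$ are
$t$-intersecting, each meets every member of $F$ in at least $t$ points, and each is contained in
every member of $G$.

Counting gives $|F| \le |T|\binom{n-s}{k-s} + O(n^{k-s-1})$. Let $M$ be the largest size of a
$t$-intersecting family of $s$-subsets of a $k$-set. The constructions reach $M\binom{n-k}{k-s}$, so
for a pair at least as large as the best of them, $F$ or $G$ has at least $M$ heavy sets
(`le_card_heavy_or`). Say it is $F$. Fix $B_0 \in G$; then $T$ is a maximum $t$-intersecting family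
of $s$-subsets of $B_0$. As $k \ge 2s-t$, the Ahlswede–Khachatryan theorem with uniqueness
(`exists_eq_centerFamily`) yields $Y \subseteq B_0$ with $|Y| = t+2r$ and $T = \{S : |S \cap Y| \ge
t+r\}$, unless $k=2s$ and $t=1$. A set meeting all of $T$ in $t$ points satisfies the condition
defining $\mathcal A_r$, and a $k$-set containing all of $T$ lies in $\mathcal B_r$; this is
`exists_perm_subset_family`.

The complete intersection theorem is proved by local exchange. In a compressed maximum family,
membership depends only on the trace on an initial segment: the last relevant element is removed by
trading sets of one trace size for another. Passing to complements, membership also depends only on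
the trace outside a slightly shorter segment. Together these force a center (`trace_dichotomy`). A
shift that has a center comes from a family that has one (`exists_center_of_shift`), which removes
the compression hypothesis.

For $k=2s$, $t=1$ uniqueness of $T$ fails, but $T$ contains exactly one set of each complementary
pair in $B_0$, which suffices for the bound on $|F|+|G|$. -/

namespace CompleteIntersection

open Finset
open scoped FinsetFamily

set_option linter.unusedSectionVars false

/-! ### Exchange argument at the last element on which a maximum family depends -/

section Intersecting

variable {α : Type*} [Fintype α] [DecidableEq α]

/-- Any two members of the family share at least `t` elements. -/
def TInt (t : ℕ) (F : Finset (Finset α)) : Prop :=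
  ∀ A ∈ F, ∀ B ∈ F, t ≤ (A ∩ B).card

/-- A `t`-intersecting family of `k`-sets of the largest possible size. -/
structure IsMaxTInt (k t : ℕ) (F : Finset (Finset α)) : Prop where
  sized : ∀ A ∈ F, A.card = k
  tint : TInt t F
  le_card : ∀ G : Finset (Finset α), (∀ A ∈ G, A.card = k) → TInt t G → G.card ≤ F.card

/-- Membership of a `k`-set in the family depends only on its trace on `S`. -/
def DependsOn (k : ℕ) (F : Finset (Finset α)) (S : Finset α) : Prop :=
  ∀ A B : Finset α, A.card = k → B.card = k → A ∩ S = B ∩ S → A ∈ F → B ∈ F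

/-- The family is closed under replacing the element `e` by `x`. -/
def ReplClosed (F : Finset (Finset α)) (e x : α) : Prop :=
  ∀ A ∈ F, e ∈ A → x ∉ A → insert x (A.erase e) ∈ F

/-- The `k`-sets whose trace on `S` lies in `Q`. -/
def traceFiber (k : ℕ) (S : Finset α) (Q : Finset (Finset α)) : Finset (Finset α) :=
  (powersetCard k univ).filter (fun A => A ∩ S ∈ Q)

theorem card_repl {A : Finset α} {e x : α} (he : e ∈ A) (hx : x ∉ A) :
    (insert x (A.erase e)).card = A.card := by
  have hx' : x ∉ A.erase e := fun h => hx (mem_of_mem_erase h)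
  have : 0 < A.card := card_pos.2 ⟨e, he⟩
  rw [card_insert_of_notMem hx', card_erase_of_mem he]
  omega

theorem card_trace_eq {k : ℕ} {S E : Finset α} (hE : E ⊆ S) (hk : E.card ≤ k) :
    ((powersetCard k univ).filter (fun A => A ∩ S = E)).card
      = (Fintype.card α - S.card).choose (k - E.card) := by
  have : (powersetCard (k - E.card) (univ \ S)).card
      = (Fintype.card α - S.card).choose (k - E.card) := by
    rw [card_powersetCard, card_sdiff, inter_univ, card_univ]
  rw [← this]
  symm
  refine card_bij (fun Q _ => E ∪ Q) ?_ ?_ ?_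
  · intro Q hQ
    rw [mem_powersetCard] at hQ
    have hd : Disjoint E Q := by
      rw [disjoint_left]; intro x hx hxQ
      exact (mem_sdiff.1 (hQ.1 hxQ)).2 (hE hx)
    simp only [mem_filter, mem_powersetCard, subset_univ, true_and]
    refine ⟨by rw [card_union_of_disjoint hd]; omega, ?_⟩
    ext x
    simp only [mem_inter, mem_union]
    refine ⟨fun h => h.1.resolve_right fun hx => (mem_sdiff.1 (hQ.1 hx)).2 h.2,
      fun h => ⟨Or.inl h, hE h⟩⟩
  · intro Q hQ Q' hQ' h
    rw [mem_powersetCard] at hQ hQ'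
    ext x
    have hx := Finset.ext_iff.1 h x
    simp only [mem_union] at hx
    have h1 : x ∈ Q → x ∉ E := fun hxQ hxE => (mem_sdiff.1 (hQ.1 hxQ)).2 (hE hxE)
    have h2 : x ∈ Q' → x ∉ E := fun hxQ hxE => (mem_sdiff.1 (hQ'.1 hxQ)).2 (hE hxE)
    tauto
  · intro A hA
    simp only [mem_filter, mem_powersetCard, subset_univ, true_and] at hA
    refine ⟨A \ S, ?_, ?_⟩
    · rw [mem_powersetCard]
      refine ⟨sdiff_subset_sdiff (subset_univ _) le_rfl, ?_⟩
      have := card_inter_add_card_sdiff A S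
      rw [hA.2] at this
      omega
    · rw [← hA.2, union_comm, sdiff_union_inter]

theorem card_traceFiber {k j : ℕ} {S : Finset α} {Q : Finset (Finset α)}
    (hQ : ∀ E ∈ Q, E ⊆ S ∧ E.card = j) (hj : j ≤ k) :
    (traceFiber k S Q).card = Q.card * (Fintype.card α - S.card).choose (k - j) := by
  unfold traceFiber
  have hmaps : Set.MapsTo (fun A => A ∩ S)
      (((powersetCard k univ).filter (fun A => A ∩ S ∈ Q) : Finset (Finset α)) : Set (Finset α))
      (Q : Set (Finset α)) := fun A hA => (mem_filter.1 (mem_coe.1 hA)).2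
  rw [card_eq_sum_card_fiberwise hmaps, sum_const_nat]
  intro E hE
  rw [filter_filter]
  rw [← (hQ E hE).2, ← card_trace_eq (hQ E hE).1 (by rw [(hQ E hE).2]; exact hj)]
  congr 1
  ext A
  simp only [mem_filter, and_congr_right_iff]
  intro _
  exact ⟨fun h => h.2, fun h => ⟨h ▸ hE, h⟩⟩

/-- A candidate $A \notin F$ whose neighbours $A - d + e$ all lie in $F$ can only fail against a
very special $B$. Any slack (a point of $A \cap B$ outside $S$, a point of $S$ uncovered by both, or
$B \cap S - e$ being a trace) produces two members of $F$ that meet in fewer than $t$ points. -/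
theorem conflict {k t : ℕ} {F : Finset (Finset α)} {S : Finset α} {e : α}
    (hsized : ∀ A ∈ F, A.card = k) (hF : TInt t F) (hdep : DependsOn k F S)
    (hS : ∀ x ∈ S, x ≠ e → ReplClosed F e x) (heS : e ∈ S)
    {A B : Finset α} (heA : e ∉ A) (hne : (A \ S).Nonempty)
    (hA : ∀ d ∈ A \ S, insert e (A.erase d) ∈ F) (hB : B ∈ F) (hlt : (A ∩ B).card < t) :
    e ∈ B ∧ insert e (A ∩ S) ∪ (B ∩ S) = S ∧
      (insert e (A ∩ S)).card + (B ∩ S).card = S.card + t ∧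
      ¬ ∃ C ∈ F, C ∩ S = (B ∩ S).erase e := by
  -- Two members of `F` cannot meet inside `A ∩ B`, which has fewer than `t` points; each case below
  -- contradicts this or the same count.
  have key : ∀ d ∈ A \ S, ∀ B' ∈ F, ¬ (insert e (A.erase d) ∩ B' ⊆ A ∩ B) := by
    intro d hd B' hB' hsub
    have := hF _ (hA d hd) _ hB'
    have := card_le_card hsub
    omega
  obtain ⟨d, hd⟩ := hne
  have hdA := (mem_sdiff.1 hd).1
  have hdS := (mem_sdiff.1 hd).2
  have heB : e ∈ B := by
    by_contra heB
    refine key d hd B hB fun x hx => ?_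
    simp only [mem_inter, mem_insert, mem_erase] at hx ⊢
    rcases hx with ⟨rfl | hx, hxB⟩
    · exact absurd hxB heB
    · exact ⟨hx.2, hxB⟩
  have hAB : A ∩ B ⊆ S := by
    intro c hc
    by_contra hcS
    have hcA := (mem_inter.1 hc).1
    have h1 := hF _ (hA c (mem_sdiff.2 ⟨hcA, hcS⟩)) _ hB
    have h2 : insert e (A.erase c) ∩ B ⊆ insert e ((A ∩ B).erase c) := by
      intro x hx
      simp only [mem_inter, mem_insert, mem_erase] at hx ⊢
      tauto
    have h3 := card_le_card h2
    have h4 := card_repl hc (x := e) (fun h => heA (mem_inter.1 h).1)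
    omega
  have hdB : d ∉ B := fun h => hdS (hAB (mem_inter.2 ⟨hdA, h⟩))
  have hcard : (A ∩ B).card + 1 = t := by
    have h1 := hF _ (hA d hd) _ hB
    have h2 : insert e (A.erase d) ∩ B ⊆ insert e (A ∩ B) := by
      intro x hx
      simp only [mem_inter, mem_insert, mem_erase] at hx ⊢
      tauto
    have h3 := card_le_card h2
    have h4 := card_insert_le e (A ∩ B)
    omega
  have hun : insert e (A ∩ S) ∪ (B ∩ S) = S := by
    ext x
    simp only [mem_union, mem_insert, mem_inter]
    constructor
    · rintro ((rfl | h) | h)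
      · exact heS
      · exact h.2
      · exact h.2
    · intro hxS
      by_contra hcon
      have hxe : x ≠ e := by tauto
      have hxA : x ∉ A := by tauto
      have hxB : x ∉ B := by tauto
      refine key d hd _ (hS x hxS hxe B hB heB hxB) fun y hy => ?_
      simp only [mem_inter, mem_insert, mem_erase] at hy ⊢
      rcases hy with ⟨rfl | hy, rfl | hyB⟩
      · exact absurd rfl hxe
      · exact absurd rfl hyB.1
      · exact absurd hy.2 hxA
      · exact ⟨hy.2, hyB.2⟩
  refine ⟨heB, hun, ?_, ?_⟩
  · have h1 := card_union_add_card_inter (insert e (A ∩ S)) (B ∩ S)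
    have h2 : insert e (A ∩ S) ∩ (B ∩ S) = insert e (A ∩ B) := by
      ext x
      have := @hAB x
      simp only [mem_inter, mem_insert] at this ⊢
      constructor
      · tauto
      · rintro (rfl | h)
        · tauto
        · tauto
    rw [hun, h2, card_insert_of_notMem (fun h => heA (mem_inter.1 h).1)] at h1
    omega
  · rintro ⟨C, hC, hCS⟩
    have hB' : insert d (B.erase e) ∈ F := by
      refine hdep C _ (hsized C hC) ((card_repl heB hdB).trans (hsized B hB)) ?_ hC
      rw [hCS]
      ext x
      simp only [mem_inter, mem_insert, mem_erase]
      constructor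
      · tauto
      · rintro ⟨rfl | h, h'⟩
        · exact absurd h' hdS
        · tauto
    refine key d hd _ hB' fun y hy => ?_
    simp only [mem_inter, mem_insert, mem_erase] at hy ⊢
    rcases hy with ⟨rfl | hy, rfl | hyB⟩
    · exact absurd hdA heA
    · exact absurd rfl hyB.1
    · exact absurd rfl hy.1
    · exact ⟨hy.2, hyB.2⟩

/-- The traces on `S` that stop being traces when `e` is removed from them. -/
def pivots (F : Finset (Finset α)) (S : Finset α) (e : α) : Finset (Finset α) :=
  S.powerset.filter (fun E => e ∈ E ∧ (∃ A ∈ F, A ∩ S = E) ∧ ¬ ∃ A ∈ F, A ∩ S = E.erase e)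

theorem mem_pivots {F : Finset (Finset α)} {S E : Finset α} {e : α} :
    E ∈ pivots F S e ↔
      E ⊆ S ∧ e ∈ E ∧ (∃ A ∈ F, A ∩ S = E) ∧ ¬ ∃ A ∈ F, A ∩ S = E.erase e := by
  simp only [pivots, mem_filter, mem_powerset]

/-- Delete from $F$ the sets with trace in $Q$ and add all $k$-sets with trace $E - e$, $E \in P$.
By `conflict` the last hypothesis keeps the result $t$-intersecting, so by maximality the gain is at
most the loss. -/
theorem replace_pivots {k t i j : ℕ} {F : Finset (Finset α)} {S : Finset α} {e : α}
    (hmax : IsMaxTInt k t F) (hdep : DependsOn k F S)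
    (hS : ∀ x ∈ S, x ≠ e → ReplClosed F e x) (heS : e ∈ S)
    {P Q : Finset (Finset α)} (hP : P ⊆ pivots F S e) (hQ : Q ⊆ pivots F S e)
    (hPi : ∀ E ∈ P, E.card = i) (hQj : ∀ E ∈ Q, E.card = j)
    (hPQ : ∀ E ∈ P, ∀ E' ∈ pivots F S e, E ∪ E' = S → E.card + E'.card = S.card + t →
      E' ∈ Q ∧ E' ∉ P) :
    P.card * (Fintype.card α - S.card).choose (k + 1 - i)
      ≤ Q.card * (Fintype.card α - S.card).choose (k - j) := by
  rcases P.eq_empty_or_nonempty with rfl | ⟨E0, hE0⟩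
  · simp
  have hcard : ∀ E ∈ pivots F S e, E.card ≤ k := by
    intro E hE
    obtain ⟨-, -, ⟨A, hA, hAE⟩, -⟩ := mem_pivots.1 hE
    rw [← hAE, ← hmax.sized A hA]
    exact card_le_card inter_subset_left
  have hpos : ∀ E ∈ pivots F S e, 1 ≤ E.card := fun E hE =>
    card_pos.2 ⟨e, (mem_pivots.1 hE).2.1⟩
  have hik : i ≤ k := hPi E0 hE0 ▸ hcard E0 (hP hE0)
  have hi1 : 1 ≤ i := hPi E0 hE0 ▸ hpos E0 (hP hE0)
  set P' := P.image (fun E => E.erase e) with hP'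
  have hP'card : P'.card = P.card := by
    refine card_image_of_injOn fun E hE E' hE' h => ?_
    have h1 := (mem_pivots.1 (hP hE)).2.1
    have h2 := (mem_pivots.1 (hP hE')).2.1
    rw [← insert_erase h1, ← insert_erase h2]
    exact congrArg _ h
  have hNew : (traceFiber k S P').card
      = P.card * (Fintype.card α - S.card).choose (k + 1 - i) := by
    rw [card_traceFiber (j := i - 1), hP'card]
    · congr 2; omega
    · intro E hE
      obtain ⟨E1, hE1, rfl⟩ := mem_image.1 hE
      have h1 := mem_pivots.1 (hP hE1)
      exact ⟨(erase_subset _ _).trans h1.1, by rw [card_erase_of_mem h1.2.1, hPi E1 hE1]⟩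
    · omega
  have hOld : (traceFiber k S Q).card ≤ Q.card * (Fintype.card α - S.card).choose (k - j) := by
    rcases Q.eq_empty_or_nonempty with rfl | ⟨E1, hE1⟩
    · simp [traceFiber]
    · rw [card_traceFiber (j := j)]
      · exact fun E hE => ⟨(mem_pivots.1 (hQ hE)).1, hQj E hE⟩
      · exact hQj E1 hE1 ▸ hcard E1 (hQ hE1)
  have hnew : ∀ A ∈ traceFiber k S P', A.card = k ∧ e ∉ A ∧ (A \ S).Nonempty ∧
      insert e (A ∩ S) ∈ P ∧ (∀ d ∈ A \ S, insert e (A.erase d) ∈ F) ∧ A ∉ F := by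
    intro A hA
    simp only [traceFiber, mem_filter, mem_powersetCard, subset_univ, true_and] at hA
    obtain ⟨hAk, hAP⟩ := hA
    obtain ⟨E, hE, hEA⟩ := mem_image.1 hAP
    obtain ⟨hES, heE, ⟨A0, hA0, hA0E⟩, hno⟩ := mem_pivots.1 (hP hE)
    have heA : e ∉ A := fun h => by
      have : e ∈ A ∩ S := mem_inter.2 ⟨h, heS⟩
      rw [← hEA] at this
      exact absurd rfl (mem_erase.1 this).1
    have hins : insert e (A ∩ S) = E := by rw [← hEA, insert_erase heE]
    refine ⟨hAk, heA, ?_, hins ▸ hE, ?_, fun h => hno ⟨A, h, hEA.symm⟩⟩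
    · rw [← card_pos]
      have h1 := card_inter_add_card_sdiff A S
      rw [← hEA, card_erase_of_mem heE, hPi E hE] at h1
      omega
    · intro d hd
      refine hdep A0 _ (hmax.sized A0 hA0) ((card_repl (mem_sdiff.1 hd).1 heA).trans hAk) ?_ hA0
      rw [hA0E, ← hins]
      have hdS := (mem_sdiff.1 hd).2
      ext x
      simp only [mem_inter, mem_insert, mem_erase]
      constructor
      · rintro (rfl | h)
        · exact ⟨Or.inl rfl, heS⟩
        · exact ⟨Or.inr ⟨fun h' => hdS (h' ▸ h.2), h.1⟩, h.2⟩
      · tauto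
  have hcross : ∀ A ∈ traceFiber k S P', ∀ B ∈ F, B ∉ traceFiber k S Q → t ≤ (A ∩ B).card := by
    intro A hA B hB hBQ
    by_contra hlt
    obtain ⟨hAk, heA, hne, hAP, hAF, -⟩ := hnew A hA
    obtain ⟨heB, hun, hsum, hno⟩ :=
      conflict hmax.sized hmax.tint hdep hS heS heA hne hAF hB (not_le.1 hlt)
    refine hBQ (mem_filter.2 ⟨mem_powersetCard.2 ⟨subset_univ _, hmax.sized B hB⟩, ?_⟩)
    exact (hPQ _ hAP _ (mem_pivots.2 ⟨inter_subset_right, mem_inter.2 ⟨heB, heS⟩,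
      ⟨B, hB, rfl⟩, hno⟩) hun hsum).1
  -- Compare `A` not with `B` but with its neighbour `B - d + e` in `F`, whose trace lies in `P`; a
  -- conflict would have to lie outside `P`.
  have hself : ∀ A ∈ traceFiber k S P', ∀ B ∈ traceFiber k S P', t ≤ (A ∩ B).card := by
    intro A hA B hB
    by_contra hlt
    obtain ⟨hAk, heA, hne, hAP, hAF, -⟩ := hnew A hA
    obtain ⟨hBk, heB, ⟨d, hd⟩, hBP, hBF, -⟩ := hnew B hB
    have hsub : A ∩ insert e (B.erase d) ⊆ A ∩ B := by
      intro x hx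
      simp only [mem_inter, mem_insert, mem_erase] at hx ⊢
      rcases hx with ⟨hx, rfl | h⟩
      · exact absurd hx heA
      · exact ⟨hx, h.2⟩
    have hdS := (mem_sdiff.1 hd).2
    have htr : insert e (B.erase d) ∩ S = insert e (B ∩ S) := by
      ext x
      simp only [mem_inter, mem_insert, mem_erase]
      constructor
      · tauto
      · rintro (rfl | h)
        · exact ⟨Or.inl rfl, heS⟩
        · exact ⟨Or.inr ⟨fun h' => hdS (h' ▸ h.2), h.1⟩, h.2⟩
    obtain ⟨-, hun, hsum, -⟩ := conflict hmax.sized hmax.tint hdep hS heS heA hne hAF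
      (hBF d hd) ((card_le_card hsub).trans_lt (not_le.1 hlt))
    rw [htr] at hun hsum
    exact (hPQ _ hAP _ (hP hBP) hun hsum).2 hBP
  have hdisj : Disjoint (F \ traceFiber k S Q) (traceFiber k S P') := by
    rw [disjoint_left]
    intro A hA hA'
    exact (hnew A hA').2.2.2.2.2 (mem_sdiff.1 hA).1
  have hle := hmax.le_card ((F \ traceFiber k S Q) ∪ traceFiber k S P') (by
      intro A hA
      rcases mem_union.1 hA with h | h
      · exact hmax.sized A (mem_sdiff.1 h).1
      · exact (hnew A h).1) (by
      intro A hA B hB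
      rcases mem_union.1 hA with h | h <;> rcases mem_union.1 hB with h' | h'
      · exact hmax.tint A (mem_sdiff.1 h).1 B (mem_sdiff.1 h').1
      · rw [inter_comm]; exact hcross B h' A (mem_sdiff.1 h).1 (mem_sdiff.1 h).2
      · exact hcross A h B (mem_sdiff.1 h').1 (mem_sdiff.1 h').2
      · exact hself A h B h')
  rw [card_union_of_disjoint hdisj] at hle
  have h5 := le_card_sdiff (traceFiber k S Q) F
  omega

/-- Since $(u+1)\binom{N}{u+1} = (N-u)\binom Nu$, the ratio of the two sides is
$\frac{(N-u)(N-v)}{(u+1)(v+1)}$, and $N-u > v+1$, $N-v > u+1$. -/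
theorem choose_mul_choose_lt {N u v : ℕ} (h : u + v + 2 ≤ N) :
    N.choose u * N.choose v < N.choose (u + 1) * N.choose (v + 1) := by
  have h1 := Nat.choose_succ_right_eq N u
  have h2 := Nat.choose_succ_right_eq N v
  have pu : 0 < N.choose u := Nat.choose_pos (by omega)
  have pv : 0 < N.choose v := Nat.choose_pos (by omega)
  have hu : v + 2 ≤ N - u := by omega
  have hv : u + 2 ≤ N - v := by omega
  by_contra hcon
  have hcon := not_lt.1 hcon
  have e : (N.choose (u + 1) * N.choose (v + 1)) * ((u + 1) * (v + 1))
      = (N.choose u * N.choose v) * ((N - u) * (N - v)) := by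
    calc _ = (N.choose (u + 1) * (u + 1)) * (N.choose (v + 1) * (v + 1)) := by ring
      _ = _ := by rw [h1, h2]; ring
  have g : (N.choose (u + 1) * N.choose (v + 1)) * ((u + 1) * (v + 1))
      ≤ (N.choose u * N.choose v) * ((u + 1) * (v + 1)) := Nat.mul_le_mul_right _ hcon
  rw [e] at g
  have g2 := Nat.le_of_mul_le_mul_left g (Nat.mul_pos pu pv)
  have g3 := Nat.mul_le_mul hu hv
  nlinarith

/-- The two $k$-sets that witness dependence on $e$ have traces differing only in $e$; compression
forces the one in $F$ to contain $e$. The other has its remaining $k+1-|E|$ points outside $S$,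
which gives the size bound and later keeps a binomial coefficient positive. -/
theorem exists_pivot {k t : ℕ} {F : Finset (Finset α)} {S : Finset α} {e : α}
    (hmax : IsMaxTInt k t F) (hdep : DependsOn k F S) (heS : e ∈ S)
    (hS' : ∀ d, d ∉ S → ReplClosed F d e) (hnot : ¬ DependsOn k F (S.erase e)) :
    ∃ E ∈ pivots F S e, k + 1 ≤ E.card + (Fintype.card α - S.card) := by
  unfold DependsOn at hnot
  push Not at hnot
  obtain ⟨A, B, hA, hB, hAB, hAF, hBF⟩ := hnot
  have hx : ∀ x, x ∈ S → x ≠ e → (x ∈ A ↔ x ∈ B) := by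
    intro x hxS hxe
    have := Finset.ext_iff.1 hAB x
    simp only [mem_inter, mem_erase] at this
    tauto
  have hcase : ¬ (e ∈ A ↔ e ∈ B) := by
    intro hiff
    refine hBF (hdep A B hA hB ?_ hAF)
    ext x
    simp only [mem_inter]
    by_cases hxe : x = e
    · subst hxe; tauto
    · have := hx x; tauto
  by_cases heA : e ∈ A
  · have heB : e ∉ B := by tauto
    have htrace : B ∩ S = (A ∩ S).erase e := by
      ext x
      simp only [mem_inter, mem_erase]
      by_cases hxe : x = e
      · subst hxe; tauto
      · have := hx x; tauto
    have heAS : e ∈ A ∩ S := mem_inter.2 ⟨heA, heS⟩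
    refine ⟨A ∩ S, mem_pivots.2 ⟨inter_subset_right, heAS, ⟨A, hAF, rfl⟩, ?_⟩, ?_⟩
    · rintro ⟨C, hC, hCS⟩
      exact hBF (hdep C B (hmax.sized C hC) hB (hCS.trans htrace.symm) hC)
    · have h1 := card_inter_add_card_sdiff B S
      have h2 : (B \ S).card ≤ (univ \ S).card := card_le_card (sdiff_subset_sdiff (subset_univ _) le_rfl)
      rw [card_sdiff (s := S) (t := univ), inter_univ, card_univ] at h2
      rw [htrace, card_erase_of_mem heAS] at h1
      have : 0 < (A ∩ S).card := card_pos.2 ⟨e, heAS⟩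
      omega
  · exfalso
    have heB : e ∈ B := by tauto
    have htrace : A ∩ S = (B ∩ S).erase e := by
      ext x
      simp only [mem_inter, mem_erase]
      by_cases hxe : x = e
      · subst hxe; tauto
      · have := hx x; tauto
    have heBS : e ∈ B ∩ S := mem_inter.2 ⟨heB, heS⟩
    have hne : (A \ S).Nonempty := by
      rw [← card_pos]
      have h1 := card_inter_add_card_sdiff A S
      have h2 : (B ∩ S).card ≤ B.card := card_le_card inter_subset_left
      have : 0 < (B ∩ S).card := card_pos.2 ⟨e, heBS⟩
      rw [htrace, card_erase_of_mem heBS] at h1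
      omega
    obtain ⟨d, hd⟩ := hne
    obtain ⟨hdA, hdS⟩ := mem_sdiff.1 hd
    refine hBF (hdep _ B ((card_repl hdA heA).trans hA) hB ?_ (hS' d hdS A hAF hdA heA))
    have : B ∩ S = insert e (A ∩ S) := by rw [htrace, insert_erase heBS]
    rw [this]
    ext x
    simp only [mem_inter, mem_insert, mem_erase]
    constructor
    · tauto
    · rintro (rfl | h)
      · exact ⟨Or.inl rfl, heS⟩
      · exact ⟨Or.inr ⟨fun h' => hdS (h' ▸ h.2), h.1⟩, h.2⟩

/-- Under the numerical condition a maximum family that is compressed around `e` does not depend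
on `e`. -/
theorem dependsOn_erase {k t : ℕ} {F : Finset (Finset α)} {S : Finset α} {e : α}
    (hmax : IsMaxTInt k t F) (hdep : DependsOn k F S) (heS : e ∈ S)
    (hS : ∀ x ∈ S, x ≠ e → ReplClosed F e x) (hS' : ∀ d, d ∉ S → ReplClosed F d e)
    (hn : 2 * k + 2 ≤ Fintype.card α + t)
    (hnum : ∀ i, 2 * i = S.card + t → i ≤ k →
      (S.card - 1) * (k + 1 - i) < (S.card - i) * (Fintype.card α - S.card + 1)) :
    DependsOn k F (S.erase e) := by
  by_contra hnot
  obtain ⟨E0, hE0, hE0k⟩ := exists_pivot hmax hdep heS hS' hnot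
  set m := S.card with hm
  set N := Fintype.card α - m with hN
  have hmn : m ≤ Fintype.card α := card_le_univ S
  have hcard : ∀ E ∈ pivots F S e, E.card ≤ k ∧ E.card ≤ m := by
    intro E hE
    obtain ⟨h1, -, ⟨A, hA, hAE⟩, -⟩ := mem_pivots.1 hE
    refine ⟨?_, card_le_card h1⟩
    rw [← hAE, ← hmax.sized A hA]
    exact card_le_card inter_subset_left
  obtain ⟨i, hi⟩ : ∃ i, i = E0.card := ⟨_, rfl⟩
  have hik : i ≤ k := hi ▸ (hcard E0 hE0).1
  have him : i ≤ m := hi ▸ (hcard E0 hE0).2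
  let lev : ℕ → Finset (Finset α) := fun i => (pivots F S e).filter (fun E => E.card = i)
  have hlev : ∀ i, lev i ⊆ pivots F S e := fun i => filter_subset _ _
  have hlevc : ∀ i, ∀ E ∈ lev i, E.card = i := fun i E hE => (mem_filter.1 hE).2
  have hE0i : E0 ∈ lev i := mem_filter.2 ⟨hE0, hi.symm⟩
  have hp : 0 < (lev i).card := card_pos.2 ⟨E0, hE0i⟩
  by_cases hij : 2 * i = m + t
  · have hnum := hnum i hij hik
    have hm2 : 0 < (S.erase e).card ∧ (S.erase e).card = m - 1 := by
      rw [card_erase_of_mem heS]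
      refine ⟨?_, rfl⟩
      by_contra h0
      have : m - i = 0 ∨ m = i := by omega
      have : m - i = 0 := by
        have : m = 1 := by
          have : 0 < m := card_pos.2 ⟨e, heS⟩
          omega
        have : 0 < i := by rw [hi]; exact card_pos.2 ⟨e, (mem_pivots.1 hE0).2.1⟩
        omega
      rw [this] at hnum
      omega
    -- A level with `2 * i = m + t` conflicts with itself. Pivots that all miss one point `l` of `S`
    -- do not conflict, since no union of two of them is `S`.
    let T : α → Finset (Finset α) := fun l => (lev i).filter (fun E => l ∉ E)
    have hsum : ∑ l ∈ S.erase e, (T l).card = (lev i).card * (m - i) := by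
      have := sum_card_bipartiteAbove_eq_sum_card_bipartiteBelow (s := S.erase e) (t := lev i)
        (fun (l : α) (E : Finset α) => l ∉ E)
      have h2 : ∀ E ∈ lev i, (bipartiteBelow (fun (l : α) (E : Finset α) => l ∉ E)
          (S.erase e) E).card = m - i := by
        intro E hE
        have hES := mem_pivots.1 (hlev i hE)
        have : bipartiteBelow (fun (l : α) (E : Finset α) => l ∉ E) (S.erase e) E = S \ E := by
          ext x
          simp only [bipartiteBelow, mem_filter, mem_erase, mem_sdiff]
          constructor
          · tauto
          · rintro ⟨h1, h2⟩
            exact ⟨⟨fun h => h2 (h ▸ hES.2.1), h1⟩, h2⟩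
        rw [this, card_sdiff_of_subset hES.1, hlevc i E hE]
      rw [sum_const_nat h2] at this
      exact this
    -- Averaging: each pivot of size `i` misses `m - i` of the `m - 1` points of `S - e`.
    obtain ⟨l, hl, hTl⟩ : ∃ l ∈ S.erase e, (lev i).card * (m - i) ≤ (T l).card * (m - 1) := by
      by_contra hcon
      push Not at hcon
      have h1 : ∑ l ∈ S.erase e, (T l).card * (m - 1) <
          ∑ l ∈ S.erase e, (lev i).card * (m - i) :=
        sum_lt_sum_of_nonempty (card_pos.1 hm2.1) hcon
      rw [← sum_mul, hsum, sum_const, hm2.2, smul_eq_mul, mul_comm] at h1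
      exact lt_irrefl _ h1
    have hlS : l ∈ S := mem_of_mem_erase hl
    have hrep := replace_pivots (i := i) (j := i) hmax hdep hS heS
      (P := T l) (Q := lev i \ T l) ((filter_subset _ _).trans (hlev i))
      (sdiff_subset.trans (hlev i)) (fun E hE => hlevc i E (mem_filter.1 hE).1)
      (fun E hE => hlevc i E (mem_sdiff.1 hE).1) (by
        intro E hE E' hE' hun hs
        have hE1 := mem_filter.1 hE
        have hnT : E' ∉ T l := by
          intro h
          have : l ∈ E ∪ E' := hun ▸ hlS
          rcases mem_union.1 this with h1 | h1
          · exact hE1.2 h1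
          · exact (mem_filter.1 h).2 h1
        have := hlevc i E hE1.1
        exact ⟨mem_sdiff.2 ⟨mem_filter.2 ⟨hE', by omega⟩, hnT⟩, hnT⟩)
    rw [card_sdiff_of_subset (filter_subset _ _), ← hm, ← hN] at hrep
    have hTle : (T l).card ≤ (lev i).card := card_le_card (filter_subset _ _)
    obtain ⟨u, hu⟩ : ∃ u, k = i + u := ⟨k - i, by omega⟩
    have e1 : k + 1 - i = u + 1 := by omega
    have e2 : k - i = u := by omega
    rw [e1, e2] at hrep
    rw [e1] at hnum
    have huN : 0 < N.choose u := Nat.choose_pos (by omega)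
    -- Adding `(T l).card * N.choose u` to both sides of the exchange inequality and using Pascal's
    -- rule.
    have h3 : (T l).card * (N + 1).choose (u + 1) ≤ (lev i).card * N.choose u := by
      rw [Nat.choose_succ_succ]
      have : ((lev i).card - (T l).card) * N.choose u + (T l).card * N.choose u
          = (lev i).card * N.choose u := by
        rw [← add_mul]; congr 1; omega
      linarith
    have h4 := Nat.add_one_mul_choose_eq N u
    have h5 : (T l).card * (N + 1) ≤ (lev i).card * (u + 1) := by
      refine Nat.le_of_mul_le_mul_right (c := N.choose u) ?_ huN
      calc (T l).card * (N + 1) * N.choose u = (T l).card * ((N + 1) * N.choose u) := by ring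
        _ = ((T l).card * (N + 1).choose (u + 1)) * (u + 1) := by rw [h4]; ring
        _ ≤ ((lev i).card * N.choose u) * (u + 1) := Nat.mul_le_mul_right _ h3
        _ = _ := by ring
    have h6 : (lev i).card * ((m - i) * (N + 1)) ≤ (lev i).card * ((m - 1) * (u + 1)) := by
      calc (lev i).card * ((m - i) * (N + 1)) = (lev i).card * (m - i) * (N + 1) := by ring
        _ ≤ (T l).card * (m - 1) * (N + 1) := Nat.mul_le_mul_right _ hTl
        _ = (T l).card * (N + 1) * (m - 1) := by ring
        _ ≤ (lev i).card * (u + 1) * (m - 1) := Nat.mul_le_mul_right _ h5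
        _ = _ := by ring
    have h7 := Nat.le_of_mul_le_mul_left h6 hp
    omega
  · obtain ⟨j, hj⟩ : ∃ j, i + j = m + t := ⟨m + t - i, by omega⟩
    -- Distinct complementary levels can be exchanged in either direction; the product of the two
    -- inequalities contradicts `choose_mul_choose_lt`.
    have hrep : ∀ i j, i + j = m + t → i ≠ j →
        (lev i).card * N.choose (k + 1 - i) ≤ (lev j).card * N.choose (k - j) := by
      intro i j hij hne
      refine replace_pivots hmax hdep hS heS (hlev i) (hlev j) (hlevc i) (hlevc j) ?_
      intro E hE E' hE' _ hs
      have := hlevc i E hE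
      refine ⟨mem_filter.2 ⟨hE', by omega⟩, fun h => ?_⟩
      have := hlevc i E' h
      omega
    have h1 := hrep i j hj (by omega)
    have h2 := hrep j i (by omega) (by omega)
    have hpos : 0 < (lev i).card * N.choose (k + 1 - i) :=
      Nat.mul_pos hp (Nat.choose_pos (by omega))
    have hq : 0 < (lev j).card := Nat.pos_of_ne_zero fun h => by
      rw [h, zero_mul] at h1; omega
    obtain ⟨E1, hE1⟩ := card_pos.1 hq
    have hjk : j ≤ k := hlevc j E1 hE1 ▸ (hcard E1 (hlev j hE1)).1
    -- As `i + j = m + t`, the required bound on `N` is exactly `2 * k + 2 ≤ Fintype.card α + t`.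
    have hlt := choose_mul_choose_lt (N := N) (u := k - i) (v := k - j) (by omega)
    rw [show k - i + 1 = k + 1 - i by omega, show k - j + 1 = k + 1 - j by omega] at hlt
    have h3 := Nat.mul_le_mul h1 h2
    have h4 : ((lev i).card * (lev j).card) * (N.choose (k - i) * N.choose (k - j))
        < ((lev i).card * (lev j).card) * (N.choose (k + 1 - i) * N.choose (k + 1 - j)) :=
      Nat.mul_lt_mul_of_pos_left hlt (Nat.mul_pos hp hq)
    nlinarith

/-! ### Compressed families depend on an initial segment -/

/-- The elements with label below `m`. -/
def seg (f : α → ℕ) (m : ℕ) : Finset α := univ.filter (fun x => f x < m)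

/-- The family is left-compressed with respect to the labelling `f`. -/
def Compressed (f : α → ℕ) (F : Finset (Finset α)) : Prop :=
  ∀ x y, f x < f y → ReplClosed F y x

/-- `f` labels the ground set by `0, 1, …`. -/
structure IsLabel (f : α → ℕ) : Prop where
  inj : Function.Injective f
  lt : ∀ x, f x < Fintype.card α

theorem IsLabel.image {f : α → ℕ} (hf : IsLabel f) : univ.image f = range (Fintype.card α) := by
  refine eq_of_subset_of_card_le (fun y hy => ?_) ?_
  · obtain ⟨x, -, rfl⟩ := mem_image.1 hy
    exact mem_range.2 (hf.lt x)
  · rw [card_image_of_injective _ hf.inj, card_range, card_univ]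

theorem IsLabel.exists_eq {f : α → ℕ} (hf : IsLabel f) {m : ℕ} (hm : m < Fintype.card α) :
    ∃ x, f x = m := by
  have : m ∈ univ.image f := by rw [hf.image]; exact mem_range.2 hm
  obtain ⟨x, -, h⟩ := mem_image.1 this
  exact ⟨x, h⟩

theorem IsLabel.card_seg {f : α → ℕ} (hf : IsLabel f) {m : ℕ} (hm : m ≤ Fintype.card α) :
    (seg f m).card = m := by
  rw [← card_image_of_injective _ hf.inj]
  convert card_range m using 2
  ext y
  simp only [seg, mem_image, mem_filter, mem_univ, true_and, mem_range]
  constructor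
  · rintro ⟨x, h, rfl⟩; exact h
  · intro h
    obtain ⟨x, rfl⟩ := hf.exists_eq (h.trans_le hm)
    exact ⟨x, h, rfl⟩

/-- Start from the whole ground set and remove the largest remaining label with `dependsOn_erase`
until only $m_0$ labels are left. -/
theorem dependsOn_seg_of_forall {k t m₀ : ℕ} {F : Finset (Finset α)} {f : α → ℕ}
    (hf : IsLabel f) (hmax : IsMaxTInt k t F) (hc : Compressed f F)
    (hn : 2 * k + 2 ≤ Fintype.card α + t) (hm₀ : m₀ ≤ Fintype.card α)
    (hnum : ∀ m, m₀ < m → m ≤ Fintype.card α → ∀ i, 2 * i = m + t → i ≤ k →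
      (m - 1) * (k + 1 - i) < (m - i) * (Fintype.card α - m + 1)) :
    DependsOn k F (seg f m₀) := by
  have key : ∀ d m, m + d = Fintype.card α → m₀ ≤ m → DependsOn k F (seg f m) := by
    intro d
    induction d with
    | zero =>
      intro m hm _ A B _ _ hAB hA
      have : seg f m = univ := by
        ext x
        have := hf.lt x
        simp only [seg, mem_filter, mem_univ, true_and, iff_true]
        omega
      rw [this, inter_univ, inter_univ] at hAB
      exact hAB ▸ hA
    | succ d ih =>
      intro m hm hm0
      have hd := ih (m + 1) (by omega) (by omega)
      obtain ⟨e, he⟩ := hf.exists_eq (m := m) (by omega)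
      have hseg : seg f m = (seg f (m + 1)).erase e := by
        ext x
        have := @hf.inj x e
        simp only [seg, mem_filter, mem_univ, true_and, mem_erase]
        constructor
        · intro h
          exact ⟨fun h' => by rw [h'] at h; omega, by omega⟩
        · rintro ⟨h1, h2⟩
          have : f x ≠ f e := fun h => h1 (this h)
          omega
      have hcs := hf.card_seg (m := m + 1) (by omega)
      rw [hseg]
      refine dependsOn_erase hmax hd (by simp [seg, he]) ?_ ?_ hn ?_
      · intro x hx hxe
        refine hc x e ?_
        have h1 : f x ≠ f e := fun h => hxe (hf.inj h)
        simp only [seg, mem_filter, mem_univ, true_and] at hx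
        omega
      · intro y hy
        refine hc e y ?_
        simp only [seg, mem_filter, mem_univ, true_and] at hy
        omega
      · rw [hcs]
        exact hnum (m + 1) (by omega) (by omega)
  exact key (Fintype.card α - m₀) m₀ (by omega) le_rfl

/-- Both inequalities have the form $(k+1-t)(t-1) < c\,(n-2(k+1-t))$: the hypothesis with $c = r+1$,
the conclusion with $c = i-t \ge r+1$. In the proof $z = n-2(k+1-t)$, and it is positive. -/
theorem level_inequality {n k t r : ℕ} (ht : 1 ≤ t)
    (h : (k + 1 - t) * (2 * r + t + 1) < n * (r + 1)) {m : ℕ} (hm : t + 2 * r < m) (hmn : m ≤ n)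
    {i : ℕ} (hi : 2 * i = m + t) (hik : i ≤ k) :
    (m - 1) * (k + 1 - i) < (m - i) * (n - m + 1) := by
  obtain ⟨ρ, rfl⟩ : ∃ ρ, i = t + ρ := ⟨i - t, by omega⟩
  obtain ⟨w, rfl⟩ : ∃ w, k = t + ρ + w := ⟨k - (t + ρ), by omega⟩
  obtain ⟨N, rfl⟩ : ∃ N, n = m + N := ⟨n - m, by omega⟩
  obtain ⟨u, rfl⟩ : ∃ u, t = u + 1 := ⟨t - 1, by omega⟩
  obtain rfl : m = u + 1 + 2 * ρ := by omega
  obtain ⟨q, rfl⟩ : ∃ q, ρ = r + 1 + q := ⟨ρ - (r + 1), by omega⟩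
  rw [show u + 1 + (r + 1 + q) + w + 1 - (u + 1) = r + 1 + q + w + 1 by omega] at h
  rw [show u + 1 + 2 * (r + 1 + q) - 1 = u + 2 * (r + 1 + q) by omega,
    show u + 1 + (r + 1 + q) + w + 1 - (u + 1 + (r + 1 + q)) = w + 1 by omega,
    show u + 1 + 2 * (r + 1 + q) - (u + 1 + (r + 1 + q)) = r + 1 + q by omega,
    show u + 1 + 2 * (r + 1 + q) + N - (u + 1 + 2 * (r + 1 + q)) = N by omega]
  zify at h ⊢
  obtain ⟨z, hz⟩ : ∃ z : ℤ, z = u + N - 1 - 2 * w := ⟨_, rfl⟩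
  have h1 : ((r : ℤ) + 1 + q + w + 1) * u < z * (r + 1) := by rw [hz]; linarith
  have hz0 : 0 < z := by
    by_contra hneg
    have : (0 : ℤ) ≤ ((r : ℤ) + 1 + q + w + 1) * u := by positivity
    nlinarith
  have h2 : (0 : ℤ) ≤ z * q := by positivity
  have h3 : ((r : ℤ) + 1 + q + w + 1) * u < z * (r + 1 + q) := by linarith
  rw [hz] at h3
  linarith

theorem dependsOn_seg {k t r : ℕ} {F : Finset (Finset α)} {f : α → ℕ}
    (hf : IsLabel f) (hmax : IsMaxTInt k t F) (hc : Compressed f F) (ht : 1 ≤ t)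
    (hn : 2 * k + 2 ≤ Fintype.card α + t) (hr : t + 2 * r ≤ Fintype.card α)
    (h : (k + 1 - t) * (2 * r + t + 1) < Fintype.card α * (r + 1)) :
    DependsOn k F (seg f (t + 2 * r)) :=
  dependsOn_seg_of_forall hf hmax hc hn hr
    fun _ hm hmn _ hi hik => level_inequality ht h hm hmn hi hik

/-! ### Complements -/

theorem card_compl_inter_compl {A B : Finset α} {k : ℕ} (hA : A.card = k) (hB : B.card = k) :
    (Aᶜ ∩ Bᶜ).card + 2 * k = Fintype.card α + (A ∩ B).card := by
  have h1 := card_union_add_card_inter A B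
  have h2 := card_compl_add_card (A ∪ B)
  rw [compl_union] at h2
  omega

theorem IsMaxTInt.compls {k t : ℕ} {F : Finset (Finset α)} (h : IsMaxTInt k t F)
    (hk : k ≤ Fintype.card α) (hn : 2 * k ≤ Fintype.card α + t) :
    IsMaxTInt (Fintype.card α - k) (Fintype.card α + t - 2 * k) Fᶜˢ := by
  refine ⟨?_, ?_, ?_⟩
  · intro A hA
    have h1 := h.sized _ (mem_compls.1 hA)
    have h2 := card_compl_add_card A
    omega
  · intro A hA B hB
    have hA := mem_compls.1 hA
    have hB := mem_compls.1 hB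
    have h1 := card_compl_inter_compl (h.sized _ hA) (h.sized _ hB)
    have h2 := h.tint _ hA _ hB
    rw [compl_compl, compl_compl] at h1
    omega
  · intro G hG hGt
    have := h.le_card Gᶜˢ ?_ ?_
    · rwa [card_compls] at this ⊢
    · intro A hA
      have h1 := hG _ (mem_compls.1 hA)
      have h2 := card_compl_add_card A
      omega
    · intro A hA B hB
      have hA := mem_compls.1 hA
      have hB := mem_compls.1 hB
      have h1 := card_compl_inter_compl (hG _ hA) (hG _ hB)
      have h2 := hGt _ hA _ hB
      rw [compl_compl, compl_compl] at h1
      omega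

theorem Compressed.compls {f g : α → ℕ} {F : Finset (Finset α)} (hc : Compressed f F)
    (hfg : ∀ x y, g x < g y → f y < f x) : Compressed g Fᶜˢ := by
  intro x y hxy A hA hy hx
  rw [mem_compls] at hA ⊢
  have h := hc y x (hfg x y hxy) _ hA (mem_compl.2 hx) (by simpa using hy)
  convert h using 1
  ext z
  simp only [mem_compl, mem_insert, mem_erase]
  by_cases hzy : z = y
  · subst hzy
    have : z ≠ x := fun h => hx (h ▸ hy)
    tauto
  · tauto

theorem DependsOn.of_compls {k : ℕ} {F : Finset (Finset α)} {S : Finset α}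
    (h : DependsOn (Fintype.card α - k) Fᶜˢ S) : DependsOn k F S := by
  intro A B hA hB hAB hAF
  have := h Aᶜ Bᶜ (by rw [card_compl, hA]) (by rw [card_compl, hB]) ?_
    (by rwa [mem_compls, compl_compl])
  · rwa [mem_compls, compl_compl] at this
  · ext x
    have := Finset.ext_iff.1 hAB x
    simp only [mem_inter, mem_compl] at this ⊢
    tauto

/-- This is `dependsOn_seg` for the family of complements and the reversed labels, with $k' = n-k$,
$t' = n+t-2k$, $r' = k-t-r$. Then $t'+2r' = n-t-2r$, and $k'+1-t' = k+1-t$ is unchanged. -/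
theorem dependsOn_compl_seg {k t r : ℕ} {F : Finset (Finset α)} {f : α → ℕ}
    (hf : IsLabel f) (hmax : IsMaxTInt k t F) (hc : Compressed f F) (ht : 2 ≤ t)
    (hn : 2 * k + 1 ≤ Fintype.card α + t) (hr : t + r ≤ k)
    (h : Fintype.card α * r < (k + 1 - t) * (2 * r + t - 1)) :
    DependsOn k F (seg f (t + 2 * r))ᶜ := by
  obtain ⟨n, hn'⟩ : ∃ n, n = Fintype.card α := ⟨_, rfl⟩
  rw [← hn'] at hn h
  have hf' : IsLabel (fun x => n - 1 - f x) := by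
    refine ⟨fun x y hxy => hf.inj ?_, fun x => ?_⟩
    · have := hf.lt x
      have := hf.lt y
      omega
    · have := hf.lt x
      omega
  have hmax' := hmax.compls (by omega) (by omega)
  have hc' := hc.compls (g := fun x => n - 1 - f x) (fun x y hxy => by
    have := hf.lt x
    have := hf.lt y
    omega)
  have hseg : (seg f (t + 2 * r))ᶜ
      = seg (fun x => n - 1 - f x) ((n + t - 2 * k) + 2 * (k - t - r)) := by
    ext x
    have := hf.lt x
    simp only [seg, mem_compl, mem_filter, mem_univ, true_and]
    omega
  rw [hseg]
  refine DependsOn.of_compls ?_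
  rw [← hn'] at hmax' ⊢
  refine dependsOn_seg hf' hmax' hc' (by omega) (by omega) (by omega) ?_
  rw [← hn']
  obtain ⟨s, rfl⟩ : ∃ s, k = t + r + s := ⟨k - t - r, by omega⟩
  obtain ⟨u, rfl⟩ : ∃ u, t = u + 1 := ⟨t - 1, by omega⟩
  obtain ⟨d, rfl⟩ : ∃ d, n = u + 2 * r + 2 * s + 2 + d := ⟨n - (u + 2 * r + 2 * s + 2), by omega⟩
  rw [show u + 1 + r + s + 1 - (u + 1) = r + s + 1 by omega,
    show 2 * r + (u + 1) - 1 = 2 * r + u by omega] at h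
  rw [show u + 2 * r + 2 * s + 2 + d - (u + 1 + r + s) + 1
      - (u + 2 * r + 2 * s + 2 + d + (u + 1) - 2 * (u + 1 + r + s)) = r + s + 1 by omega,
    show u + 1 + r + s - (u + 1) - r = s by omega,
    show u + 2 * r + 2 * s + 2 + d + (u + 1) - 2 * (u + 1 + r + s) = d + 1 by omega]
  nlinarith

/-! ### The center of a compressed maximum family -/

theorem repl_inter_of_mem {A X : Finset α} {x y : α} (hy : y ∉ X) (hx : x ∈ X) :
    insert x (A.erase y) ∩ X = insert x (A ∩ X) := by
  ext z
  simp only [mem_inter, mem_insert, mem_erase]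
  constructor
  · tauto
  · rintro (rfl | h)
    · exact ⟨Or.inl rfl, hx⟩
    · exact ⟨Or.inr ⟨fun h' => hy (h' ▸ h.2), h.1⟩, h.2⟩

theorem card_repl_inter {A X : Finset α} {x y : α} (hy : y ∉ X) (hx : x ∈ X) (hxA : x ∉ A) :
    (insert x (A.erase y) ∩ X).card = (A ∩ X).card + 1 := by
  rw [repl_inter_of_mem hy hx, card_insert_of_notMem fun h => hxA (mem_inter.1 h).1]

theorem exists_mem_sdiff_of_card_lt {A X : Finset α} (h : (A ∩ X).card < A.card) :
    ∃ y ∈ A, y ∉ X := by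
  by_contra hcon
  push Not at hcon
  rw [inter_eq_left.2 hcon] at h
  exact lt_irrefl _ h

theorem exists_trace_card_succ {k c : ℕ} {F : Finset (Finset α)} {X : Finset α}
    (hF : ∀ A ∈ F, A.card = k) (hX : ∀ x ∈ X, ∀ y, y ∉ X → ReplClosed F y x)
    (hck : c ≤ k) (hcX : c ≤ X.card) {A : Finset α} (hA : A ∈ F) (hlt : (A ∩ X).card < c) :
    ∃ B ∈ F, (B ∩ X).card + 1 = c := by
  obtain ⟨B, hB, hBmax⟩ := exists_max_image (F.filter fun A => (A ∩ X).card < c)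
    (fun A => (A ∩ X).card) ⟨A, mem_filter.2 ⟨hA, hlt⟩⟩
  obtain ⟨hBF, hBc⟩ := mem_filter.1 hB
  refine ⟨B, hBF, ?_⟩
  by_contra hne
  obtain ⟨y, hyB, hyX⟩ := exists_mem_sdiff_of_card_lt (A := B) (X := X) (by rw [hF B hBF]; omega)
  obtain ⟨x, hxX, hxB⟩ := exists_mem_sdiff_of_card_lt (A := X) (X := B)
    (by rw [inter_comm]; omega)
  have h1 := card_repl_inter (A := B) hyX hxX hxB
  have := hBmax _ (mem_filter.2 ⟨hX x hxX y hyX B hBF hyB hxB, by omega⟩)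
  omega

/-- Among the members with at most $c$ points in $X_2$, take one with the most points in $X$. As
long as it has fewer than $c$ there, a point of $X_2 \setminus X$, or failing that a point outside
$X_2$, can be moved into $X$. -/
theorem exists_trace_subset {k c : ℕ} {F : Finset (Finset α)} {X X₂ : Finset α}
    (hF : ∀ A ∈ F, A.card = k) (hX : ∀ x ∈ X, ∀ y, y ∉ X → ReplClosed F y x) (hXX : X ⊆ X₂)
    (hck : c ≤ k) (hcX : c ≤ X.card) {A : Finset α} (hA : A ∈ F) (hle : (A ∩ X₂).card ≤ c) :
    ∃ B ∈ F, (B ∩ X).card = c ∧ B ∩ X₂ ⊆ X := by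
  obtain ⟨B, hB, hBmax⟩ := exists_max_image (F.filter fun A => (A ∩ X₂).card ≤ c)
    (fun A => (A ∩ X).card) ⟨A, mem_filter.2 ⟨hA, hle⟩⟩
  obtain ⟨hBF, hBc⟩ := mem_filter.1 hB
  have hsub : B ∩ X ⊆ B ∩ X₂ := inter_subset_inter_left hXX
  have hge : c ≤ (B ∩ X).card := by
    by_contra hlt
    obtain ⟨x, hxX, hxB⟩ := exists_mem_sdiff_of_card_lt (A := X) (X := B)
      (by rw [inter_comm]; omega)
    by_cases hex : ∃ y ∈ B ∩ X₂, y ∉ X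
    · obtain ⟨y, hy, hyX⟩ := hex
      obtain ⟨hyB, hyX₂⟩ := mem_inter.1 hy
      have h1 := card_repl_inter (A := B) hyX hxX hxB
      have h2 : (insert x (B.erase y) ∩ X₂).card ≤ c := by
        have : insert x (B.erase y) ∩ X₂ ⊆ insert x ((B ∩ X₂).erase y) := by
          intro z hz
          simp only [mem_inter, mem_insert, mem_erase] at hz ⊢
          tauto
        refine (card_le_card this).trans ?_
        rw [card_repl hy fun h => hxB (mem_inter.1 h).1]
        exact hBc
      have := hBmax _ (mem_filter.2 ⟨hX x hxX y hyX B hBF hyB hxB, h2⟩)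
      omega
    · push Not at hex
      have heq : B ∩ X₂ = B ∩ X :=
        Subset.antisymm (fun y hy => mem_inter.2 ⟨(mem_inter.1 hy).1, hex y hy⟩) hsub
      obtain ⟨y, hyB, hyX₂⟩ := exists_mem_sdiff_of_card_lt (A := B) (X := X₂)
        (by rw [hF B hBF, heq]; omega)
      have hyX : y ∉ X := fun h => hyX₂ (hXX h)
      have h1 := card_repl_inter (A := B) hyX hxX hxB
      have h2 := card_repl_inter (A := B) hyX₂ (hXX hxX) hxB
      have := hBmax _ (mem_filter.2 ⟨hX x hxX y hyX B hBF hyB hxB, by rw [h2, heq]; omega⟩)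
      omega
  have heq := eq_of_subset_of_card_le hsub (by omega)
  refine ⟨B, hBF, le_antisymm ((card_le_card hsub).trans hBc) hge, ?_⟩
  rw [← heq]
  exact inter_subset_right

/-- Suppose both alternatives fail, by $A$ on $X$ and by $C$ on $X_2$. Normalise so that $|A \cap X|
= t+r-1$, $|C \cap X| = t+r$ and $C \cap X_2 \subseteq X$. The two dependences allow $A$ to be
altered freely outside $X_2$ and freely inside $X$; altered so as to avoid $C$ as far as possible,
it meets $C$ in at most $t+r-1-r = t-1$ points. -/
theorem trace_dichotomy {k t r : ℕ} {F : Finset (Finset α)} {f : α → ℕ} (hf : IsLabel f)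
    (hF : ∀ A ∈ F, A.card = k) (hFt : TInt t F) (hc : Compressed f F) (ht : 1 ≤ t)
    (hr : t + r ≤ k) (hn : 2 * k + 2 ≤ Fintype.card α + t)
    (hdep : DependsOn k F (seg f (t + 2 * r + 2))) (hdep' : DependsOn k F (seg f (t + 2 * r))ᶜ) :
    (∀ A ∈ F, t + r ≤ (A ∩ seg f (t + 2 * r)).card) ∨
      ∀ A ∈ F, t + r + 1 ≤ (A ∩ seg f (t + 2 * r + 2)).card := by
  have hXc := hf.card_seg (m := t + 2 * r) (by omega)
  have hX₂c := hf.card_seg (m := t + 2 * r + 2) (by omega)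
  have hXX : seg f (t + 2 * r) ⊆ seg f (t + 2 * r + 2) := by
    intro x; simp only [seg, mem_filter, mem_univ, true_and]; omega
  have hX : ∀ x ∈ seg f (t + 2 * r), ∀ y, y ∉ seg f (t + 2 * r) → ReplClosed F y x := by
    intro x hx y hy
    refine hc x y ?_
    simp only [seg, mem_filter, mem_univ, true_and] at hx hy
    omega
  obtain ⟨a, ha⟩ := hf.exists_eq (m := t + 2 * r) (by omega)
  have haX : a ∉ seg f (t + 2 * r) := by simp [seg, ha]
  have haX₂ : a ∈ seg f (t + 2 * r + 2) := by simp [seg, ha]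
  have hXa : ∀ y, y ∉ seg f (t + 2 * r) → y ≠ a → f a < f y := by
    intro y hy hya
    have : f y ≠ f a := fun h => hya (hf.inj h)
    simp only [seg, mem_filter, mem_univ, true_and] at hy
    omega
  set X := seg f (t + 2 * r) with hXdef
  set X₂ := seg f (t + 2 * r + 2) with hX₂def
  by_contra hcon
  push Not at hcon
  obtain ⟨⟨A, hA, hAX⟩, C, hC, hCX⟩ := hcon
  obtain ⟨C, hC, hCc, hCs⟩ := exists_trace_subset hF hX hXX (c := t + r) hr (by omega) hC (by omega)
  obtain ⟨A, hA, hAc⟩ := exists_trace_card_succ hF hX (c := t + r) hr (by omega) hA hAX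
  -- With `a ∈ A` the trace on `X₂` has at least `t + r` points, so the rest of `A` fits outside `X₂
  -- ∪ C`.
  obtain ⟨A, hA, hAc, haA⟩ : ∃ A ∈ F, (A ∩ X).card + 1 = t + r ∧ a ∈ A := by
    by_cases haA : a ∈ A
    · exact ⟨A, hA, hAc, haA⟩
    · obtain ⟨y, hyA, hyX⟩ := exists_mem_sdiff_of_card_lt (A := A) (X := X)
        (by rw [hF A hA]; omega)
      refine ⟨_, hc a y (hXa y hyX fun h => haA (h ▸ hyA)) A hA hyA haA, ?_, mem_insert_self _ _⟩
      rw [← hAc]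
      congr 2
      ext z
      simp only [mem_inter, mem_insert, mem_erase]
      constructor
      · rintro ⟨rfl | h, h'⟩
        · exact absurd h' haX
        · exact ⟨h.2, h'⟩
      · rintro ⟨h, h'⟩
        exact ⟨Or.inr ⟨fun h2 => hyX (h2 ▸ h'), h⟩, h'⟩
  have hAk := hF A hA
  have hCk := hF C hC
  have hA₂ : t + r ≤ (A ∩ X₂).card := by
    rw [← hAc, ← card_insert_of_notMem (fun h => haX (mem_inter.1 h).2)]
    refine card_le_card fun z hz => ?_
    rcases mem_insert.1 hz with rfl | h
    · exact mem_inter.2 ⟨haA, haX₂⟩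
    · exact mem_inter.2 ⟨(mem_inter.1 h).1, hXX (mem_inter.1 h).2⟩
  have hXC : (X \ C).card = r := by
    have := card_inter_add_card_sdiff X C
    rw [inter_comm] at this
    omega
  obtain ⟨P, hP1, hP2, hPc⟩ := exists_subsuperset_card_eq (s := X \ C) (t := X)
    (n := (A ∩ X).card) sdiff_subset (by omega) (card_le_card inter_subset_right)
  have hout : (A \ X₂).card ≤ (univ \ (X₂ ∪ C)).card := by
    have h1 := card_inter_add_card_sdiff A X₂
    have h2 : (X₂ ∪ C).card + (t + r) = t + 2 * r + 2 + k := by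
      have := card_union_add_card_inter X₂ C
      have h3 : X₂ ∩ C = C ∩ X := by
        rw [inter_comm]
        exact Subset.antisymm (fun z hz => mem_inter.2 ⟨(mem_inter.1 hz).1, hCs hz⟩)
          (inter_subset_inter_left hXX)
      rw [h3] at this
      omega
    rw [← compl_eq_univ_sdiff, card_compl]
    omega
  obtain ⟨Q, hQ1, hQc⟩ := exists_subset_card_eq hout
  have hQX₂ : ∀ z ∈ Q, z ∉ X₂ ∧ z ∉ C := fun z hz => by
    have := (mem_sdiff.1 (hQ1 hz)).2
    rw [mem_union] at this
    tauto
  -- Dependence on `X₂` moves the part of `A` outside `X₂` off `C`.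
  have hB1 : (A ∩ X₂) ∪ Q ∈ F := by
    refine hdep A _ hAk ?_ ?_ hA
    · rw [card_union_of_disjoint, hQc, card_inter_add_card_sdiff, hAk]
      rw [disjoint_left]
      exact fun z hz hzQ => (hQX₂ z hzQ).1 (mem_inter.1 hz).2
    · ext z
      have := hQX₂ z
      simp only [mem_inter, mem_union]
      tauto
  -- Dependence on the complement of `X` replaces the part inside `X` by `P`, which contains all `r`
  -- points of `X \ C`.
  have hB2 : P ∪ (((A ∩ X₂) ∪ Q) \ X) ∈ F := by
    refine hdep' _ _ (hF _ hB1) ?_ ?_ hB1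
    · rw [card_union_of_disjoint, hPc, ← hF _ hB1, ← card_inter_add_card_sdiff ((A ∩ X₂) ∪ Q) X]
      · congr 2
        ext z
        have := hQX₂ z
        have := @hXX z
        simp only [mem_inter, mem_union]
        tauto
      · rw [disjoint_left]
        exact fun z hz hz' => (mem_sdiff.1 hz').2 (hP2 hz)
    · ext z
      have := @hP2 z
      simp only [mem_inter, mem_union, mem_compl, mem_sdiff]
      tauto
  have h1 := hFt _ hB2 _ hC
  have h2 : (P ∪ (((A ∩ X₂) ∪ Q) \ X)) ∩ C ⊆ P \ (X \ C) := by
    intro z hz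
    have h3 := hQX₂ z
    have h4 := @hCs z
    simp only [mem_inter, mem_union, mem_sdiff] at hz h4 ⊢
    rcases hz with ⟨h | ⟨h | h, h'⟩, hzC⟩
    · tauto
    · exact absurd (h4 ⟨hzC, h.2⟩) h'
    · exact absurd hzC (h3 h).2
  have h3 := card_le_card h2
  rw [card_sdiff_of_subset hP1] at h3
  omega

/-- The structure of compressed maximum families. -/
theorem exists_center_of_compressed {k t : ℕ} {F : Finset (Finset α)} {f : α → ℕ} (hf : IsLabel f)
    (hmax : IsMaxTInt k t F) (hc : Compressed f F) (ht : 1 ≤ t) (htk : t ≤ k)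
    (hn : 2 * k + 1 ≤ Fintype.card α + t) (hne : t = 1 → 2 * k + 1 ≤ Fintype.card α) :
    ∃ r Y, t + r ≤ k ∧ Y.card = t + 2 * r ∧ (t + r = k ∨ 2 * k + 2 ≤ Fintype.card α + t) ∧
      (r = 0 ∨ 2 ≤ t) ∧ ∀ A ∈ F, t + r ≤ (A ∩ Y).card := by
  obtain ⟨n, hn'⟩ : ∃ n, n = Fintype.card α := ⟨_, rfl⟩
  have hFne : F.Nonempty := by
    obtain ⟨A, hA⟩ := exists_subset_card_eq (s := (univ : Finset α)) (n := k)
      (by rw [card_univ]; omega)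
    rw [← card_pos]
    refine lt_of_lt_of_le ?_ (hmax.le_card {A} (by simp [hA.2]) ?_)
    · simp
    · intro B hB C hC
      rw [mem_singleton.1 hB, mem_singleton.1 hC, inter_self, hA.2]
      exact htk
  rcases ht.eq_or_lt with rfl | ht2
  · have h1 := hne rfl
    -- For `t = 1` membership depends on one point; a member missing that point would have a
    -- disjoint copy in `F`.
    have hd := dependsOn_seg hf hmax hc le_rfl (r := 0) (by omega) (by omega)
      (by rw [← hn'] at h1 ⊢; simp; omega)
    refine ⟨0, seg f 1, by omega, hf.card_seg (by omega), Or.inr (by omega), Or.inl rfl, ?_⟩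
    intro A hA
    by_contra hlt
    have hA0 : A ∩ seg f 1 = ∅ := card_eq_zero.1 (by omega)
    have hAk := hmax.sized A hA
    have hs := hf.card_seg (m := 1) (by omega)
    have : k ≤ (univ \ (seg f 1 ∪ A)).card := by
      rw [card_sdiff, inter_univ, card_univ]
      have := card_union_le (seg f 1) A
      omega
    obtain ⟨B, hB, hBk⟩ := exists_subset_card_eq this
    have hB' : ∀ z ∈ B, z ∉ seg f 1 ∧ z ∉ A := fun z hz => by
      have := (mem_sdiff.1 (hB hz)).2
      rw [mem_union] at this
      tauto
    have hBF : B ∈ F := by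
      refine hd A B hAk hBk ?_ hA
      simp only [mul_zero, add_zero]
      rw [hA0]
      symm
      rw [← disjoint_iff_inter_eq_empty, disjoint_left]
      exact fun z hz => (hB' z hz).1
    have := hmax.tint A hA B hBF
    have h0 : A ∩ B = ∅ := by
      rw [← disjoint_iff_inter_eq_empty, disjoint_left]
      exact fun z hz hzB => (hB' z hzB).2 hz
    rw [h0, card_empty] at this
    omega
  · rcases hn.eq_or_lt with hn1 | hn2
    · obtain ⟨b, rfl⟩ : ∃ b, k = t + b := ⟨k - t, by omega⟩
      obtain ⟨u, rfl⟩ : ∃ u, t = u + 2 := ⟨t - 2, by omega⟩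
      -- When `n + t = 2 * k + 1`, the segment of length `t + 2 * b` omits a single point, and
      -- membership depends on that point only.
      have hd := dependsOn_compl_seg hf hmax hc ht2 (r := b) (by omega) (by omega) (by
        rw [← hn'] at hn1 ⊢
        rw [show n = 2 * b + u + 3 by omega, show u + 2 + b + 1 - (u + 2) = b + 1 by omega,
          show 2 * b + (u + 2) - 1 = 2 * b + u + 1 by omega]
        nlinarith)
      have hs := hf.card_seg (m := u + 2 + 2 * b) (by omega)
      set X := seg f (u + 2 + 2 * b) with hX
      refine ⟨b, X, le_rfl, hs, Or.inl rfl, Or.inr ht2, ?_⟩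
      intro A hA
      by_contra hlt
      have hAk := hmax.sized A hA
      obtain ⟨w, hwA, hwX⟩ := exists_mem_sdiff_of_card_lt (A := A) (X := X) (by omega)
      have hXc : Xᶜ = {w} := by
        symm
        refine eq_of_subset_of_card_le (by simpa using hwX) ?_
        rw [card_compl, card_singleton]
        omega
      have hAc := card_compl_add_card A
      have hins : (insert w Aᶜ).card = Fintype.card α - (u + 2 + b) + 1 := by
        rw [card_insert_of_notMem (by simpa using hwA)]
        omega
      -- If a member `A` contained the omitted point `w`, so would this `B`, which contains the
      -- complement of `A` and hence meets `A` in at most `t - 1` points.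
      obtain ⟨B, hB, -, hBk⟩ := exists_subsuperset_card_eq (s := insert w Aᶜ) (t := univ)
        (n := u + 2 + b) (subset_univ _) (by omega) (by rw [card_univ]; omega)
      have hBF : B ∈ F := by
        refine hd A B hAk hBk ?_ hA
        rw [hXc, inter_singleton_of_mem hwA, inter_singleton_of_mem (hB (mem_insert_self _ _))]
      have h1 := hmax.tint A hA B hBF
      have h2 := card_inter_add_card_sdiff B A
      have h3 : Aᶜ.card ≤ (B \ A).card := card_le_card fun z hz =>
        mem_sdiff.2 ⟨hB (mem_insert_of_mem hz), mem_compl.1 hz⟩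
      rw [inter_comm] at h2
      omega
    · have hex : ∃ r, (k + 1 - t) * (2 * r + t + 1) ≤ n * (r + 1) := by
        refine ⟨k - t, ?_⟩
        rw [show k - t + 1 = k + 1 - t by omega, mul_comm]
        exact Nat.mul_le_mul_right _ (by omega)
      classical
      -- The inequality at `r`, with `2 * (k + 1 - t) < n`, makes it strict at `r + 1`, giving
      -- dependence on the segment of length `t + 2 * r + 2`. Its failure at `r - 1` gives
      -- dependence on the complement of the segment of length `t + 2 * r`.
      obtain ⟨r, hr, hrmin⟩ : ∃ r, (k + 1 - t) * (2 * r + t + 1) ≤ n * (r + 1) ∧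
          ∀ q < r, ¬ (k + 1 - t) * (2 * q + t + 1) ≤ n * (q + 1) :=
        ⟨Nat.find hex, Nat.find_spec hex, fun q hq => Nat.find_min hex hq⟩
      have hrk : t + r ≤ k := by
        by_contra hlt
        refine hrmin (k - t) (by omega) ?_
        rw [show k - t + 1 = k + 1 - t by omega, mul_comm]
        exact Nat.mul_le_mul_right _ (by omega)
      have hd1 := dependsOn_seg hf hmax hc ht (r := r + 1) (by omega) (by omega) (by
        rw [← hn']
        have : 2 * (k + 1 - t) < n := by omega
        nlinarith)
      have hd2 := dependsOn_compl_seg hf hmax hc ht2 (r := r) (by omega) hrk (by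
        rw [← hn']
        rcases Nat.eq_zero_or_pos r with rfl | hpos
        · rw [mul_zero]
          exact Nat.mul_pos (by omega) (by omega)
        · have := hrmin (r - 1) (by omega)
          rw [show r - 1 + 1 = r by omega, show 2 * (r - 1) + t + 1 = 2 * r + t - 1 by omega] at this
          omega)
      rw [show t + 2 * (r + 1) = t + 2 * r + 2 by ring] at hd1
      rcases trace_dichotomy hf hmax.sized hmax.tint hc ht hrk (by omega) hd1 hd2 with h | h
      · exact ⟨r, _, hrk, hf.card_seg (by omega), Or.inr (by omega), Or.inr ht2, h⟩
      · obtain ⟨A, hA⟩ := hFne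
        have h1 := h A hA
        have h2 : (A ∩ seg f (t + 2 * r + 2)).card ≤ A.card := card_le_card inter_subset_left
        rw [hmax.sized A hA] at h2
        refine ⟨r + 1, _, by omega, hf.card_seg (m := t + 2 * r + 2) (by omega),
          Or.inr (by omega), Or.inr ht2, h⟩

/-! ### Shifts -/

/-- Replace `y` by `x` in `A`, unless the result is not new to `F`. -/
def shiftSet (F : Finset (Finset α)) (x y : α) (A : Finset α) : Finset α :=
  if y ∈ A ∧ x ∉ A ∧ insert x (A.erase y) ∉ F then insert x (A.erase y) else A

/-- The shift of a family, replacing `y` by `x`. -/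
def shift (F : Finset (Finset α)) (x y : α) : Finset (Finset α) := F.image (shiftSet F x y)

theorem repl_repl {A : Finset α} {x y : α} (hy : y ∈ A) (hx : x ∉ A) :
    insert y ((insert x (A.erase y)).erase x) = A := by
  rw [erase_insert (fun h => hx (mem_of_mem_erase h)), insert_erase hy]

theorem notMem_repl {A : Finset α} {x y : α} (hy : y ∈ A) (hx : x ∉ A) :
    y ∉ insert x (A.erase y) := by
  simp only [mem_insert, mem_erase]
  rintro (rfl | h)
  · exact hx hy
  · exact h.1 rfl

theorem mem_shift {F : Finset (Finset α)} {x y : α} {A : Finset α} :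
    A ∈ shift F x y ↔ (A ∈ F ∧ (y ∈ A → x ∉ A → insert x (A.erase y) ∈ F)) ∨
      (A ∉ F ∧ x ∈ A ∧ y ∉ A ∧ insert y (A.erase x) ∈ F) := by
  constructor
  · intro h
    obtain ⟨B, hB, hBA⟩ := mem_image.1 h
    unfold shiftSet at hBA
    split_ifs at hBA with hc
    · right
      obtain ⟨hy, hx, hn⟩ := hc
      rw [← hBA, repl_repl hy hx]
      exact ⟨hn, mem_insert_self _ _, notMem_repl hy hx, hB⟩
    · left
      rw [← hBA]
      refine ⟨hB, fun hy hx => ?_⟩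
      by_contra hn
      exact hc ⟨hy, hx, hn⟩
  · rintro (⟨hA, h⟩ | ⟨hA, hx, hy, hB⟩)
    · refine mem_image.2 ⟨A, hA, ?_⟩
      unfold shiftSet
      rw [if_neg]
      rintro ⟨h1, h2, h3⟩
      exact h3 (h h1 h2)
    · refine mem_image.2 ⟨_, hB, ?_⟩
      unfold shiftSet
      rw [repl_repl hx hy, if_pos]
      exact ⟨mem_insert_self _ _, notMem_repl hx hy, hA⟩

theorem shiftSet_injOn (F : Finset (Finset α)) (x y : α) :
    Set.InjOn (shiftSet F x y) (F : Set (Finset α)) := by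
  intro A hA B hB h
  unfold shiftSet at h
  split_ifs at h with h1 h2 h2
  · rw [← repl_repl h1.1 h1.2.1, h, repl_repl h2.1 h2.2.1]
  · exact absurd (h ▸ mem_coe.1 hB) h1.2.2
  · exact absurd (h ▸ mem_coe.1 hA) h2.2.2
  · exact h

theorem card_shift (F : Finset (Finset α)) (x y : α) : (shift F x y).card = F.card :=
  card_image_of_injOn (shiftSet_injOn F x y)

theorem sized_shift {k : ℕ} {F : Finset (Finset α)} (hF : ∀ A ∈ F, A.card = k) (x y : α) :
    ∀ A ∈ shift F x y, A.card = k := by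
  intro A hA
  rcases mem_shift.1 hA with ⟨h, -⟩ | ⟨-, hx, hy, hB⟩
  · exact hF A h
  · rw [← hF _ hB, card_repl hx hy]

theorem tInt_shift {t : ℕ} {F : Finset (Finset α)} (hF : TInt t F) (x y : α) :
    TInt t (shift F x y) := by
  have mixed : ∀ A ∈ F, (y ∈ A → x ∉ A → insert x (A.erase y) ∈ F) → ∀ B, B ∉ F → x ∈ B →
      y ∉ B → insert y (B.erase x) ∈ F → t ≤ (A ∩ B).card := by
    intro A hA hA' B _ hx hy hB
    by_cases hcase : y ∈ A ∧ x ∉ A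
    · have h := hF _ (hA' hcase.1 hcase.2) _ hB
      refine h.trans (card_le_card fun z hz => ?_)
      simp only [mem_inter, mem_insert, mem_erase] at hz ⊢
      rcases hz with ⟨rfl | h1, rfl | h2⟩
      · exact absurd hx hy
      · exact absurd rfl h2.1
      · exact absurd rfl h1.1
      · exact ⟨h1.2, h2.2⟩
    · have h := hF _ hA _ hB
      refine h.trans ?_
      by_cases hyA : y ∈ A
      · have hxA : x ∈ A := by tauto
        have : A ∩ insert y (B.erase x) ⊆ insert y ((A ∩ B).erase x) := by
          intro z hz
          simp only [mem_inter, mem_insert, mem_erase] at hz ⊢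
          tauto
        refine (card_le_card this).trans ?_
        rw [card_repl (mem_inter.2 ⟨hxA, hx⟩) (fun h => hy (mem_inter.1 h).2)]
      · refine card_le_card fun z hz => ?_
        simp only [mem_inter, mem_insert, mem_erase] at hz ⊢
        rcases hz with ⟨h1, rfl | h2⟩
        · exact absurd h1 hyA
        · exact ⟨h1, h2.2⟩
  intro A hA B hB
  rcases mem_shift.1 hA with ⟨h1, h2⟩ | ⟨h1, hx, hy, h2⟩ <;>
    rcases mem_shift.1 hB with ⟨h3, h4⟩ | ⟨h3, hx', hy', h4⟩
  · exact hF A h1 B h3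
  · exact mixed A h1 h2 B h3 hx' hy' h4
  · rw [inter_comm]
    exact mixed B h3 h4 A h1 hx hy h2
  · have h := hF _ h2 _ h4
    have : insert y (A.erase x) ∩ insert y (B.erase x) = insert y ((A ∩ B).erase x) := by
      ext z
      simp only [mem_inter, mem_insert, mem_erase]
      tauto
    rw [this, card_repl (mem_inter.2 ⟨hx, hx'⟩) (fun h => hy (mem_inter.1 h).1)] at h
    exact h

theorem IsMaxTInt.shift {k t : ℕ} {F : Finset (Finset α)} (h : IsMaxTInt k t F) (x y : α) :
    IsMaxTInt k t (shift F x y) :=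
  ⟨sized_shift h.sized x y, tInt_shift h.tint x y, fun G hG hGt => by
    rw [card_shift]; exact h.le_card G hG hGt⟩

theorem IsMaxTInt.eq_of_subset {k t : ℕ} {F G : Finset (Finset α)} (h : IsMaxTInt k t F)
    (hG : ∀ A ∈ G, A.card = k) (hGt : TInt t G) (hFG : F ⊆ G) : F = G :=
  eq_of_subset_of_card_le hFG (h.le_card G hG hGt)

/-! ### Center families and recovering a center from a shift -/

/-- The `k`-sets sharing at least `c` elements with `Y`. -/
def centerFamily (k c : ℕ) (Y : Finset α) : Finset (Finset α) :=
  (powersetCard k univ).filter (fun A => c ≤ (A ∩ Y).card)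

theorem mem_centerFamily {k c : ℕ} {Y A : Finset α} :
    A ∈ centerFamily k c Y ↔ A.card = k ∧ c ≤ (A ∩ Y).card := by
  simp [centerFamily, mem_powersetCard]

theorem le_card_inter_of_center {t r : ℕ} {A B Y : Finset α} (hY : Y.card = t + 2 * r)
    (hA : t + r ≤ (A ∩ Y).card) (hB : t + r ≤ (B ∩ Y).card) : t ≤ (A ∩ B).card := by
  have h1 := card_union_add_card_inter (A ∩ Y) (B ∩ Y)
  have h2 : ((A ∩ Y) ∪ (B ∩ Y)).card ≤ Y.card :=
    card_le_card (union_subset inter_subset_right inter_subset_right)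
  have h3 : ((A ∩ Y) ∩ (B ∩ Y)).card ≤ (A ∩ B).card :=
    card_le_card (inter_subset_inter inter_subset_left inter_subset_left)
  omega

theorem tInt_centerFamily {k t r : ℕ} {Y : Finset α} (hY : Y.card = t + 2 * r) :
    TInt t (centerFamily k (t + r) Y) := fun _ hA _ hB =>
  le_card_inter_of_center hY (mem_centerFamily.1 hA).2 (mem_centerFamily.1 hB).2

theorem IsMaxTInt.eq_centerFamily {k t r : ℕ} {F : Finset (Finset α)} {Y : Finset α}
    (h : IsMaxTInt k t F) (hY : Y.card = t + 2 * r) (hF : ∀ A ∈ F, t + r ≤ (A ∩ Y).card) :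
    F = centerFamily k (t + r) Y :=
  h.eq_of_subset (fun _ hA => (mem_centerFamily.1 hA).1) (tInt_centerFamily hY)
    fun A hA => mem_centerFamily.2 ⟨h.sized A hA, hF A hA⟩

/-- `A` is a `k`-set with `x ∈ A`, `y ∉ A` and `|A ∩ Y| = c`. -/
structure IsSlice (k c : ℕ) (Y : Finset α) (x y : α) (A : Finset α) : Prop where
  card : A.card = k
  mem : x ∈ A
  notMem : y ∉ A
  trace : (A ∩ Y).card = c

/-- Choose $C \cap Y$ of size $t+r$ containing $x$ and every point of $Y$ missed by $A$ or $B$, and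
the rest of $C$ off $A \cup B \cup Y \cup \{y\}$. Then $C \cap Y$ covers $Y$ together with $A \cap
Y$, and also with $B \cap Y$, so $|A \cap C| = |B \cap C| = 2(t+r)-(t+2r) = t$. -/
theorem exists_common_neighbour {k t r : ℕ} {Y A B : Finset α} {x y : α}
    (hY : Y.card = t + 2 * r) (hr : t + r ≤ k) (hxY : x ∈ Y) (hyY : y ∉ Y)
    (hAY : (A ∩ Y).card = t + r) (hBY : (B ∩ Y).card = t + r)
    (hin : (Y \ (A ∩ B)).card + 1 ≤ t + r)
    (hout : t + 2 * r + 1 + ((A ∪ B) \ Y).card + (k - t - r) ≤ Fintype.card α) :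
    ∃ C, IsSlice k (t + r) Y x y C ∧ (A ∩ C).card = t ∧ (B ∩ C).card = t := by
  have hle : (insert x (Y \ (A ∩ B))).card ≤ t + r := (card_insert_le _ _).trans hin
  obtain ⟨P, hP1, hP2, hPc⟩ := exists_subsuperset_card_eq (s := insert x (Y \ (A ∩ B))) (t := Y)
    (n := t + r) (insert_subset hxY sdiff_subset) hle (by omega)
  have hcard : k - t - r ≤ (univ \ (insert y (Y ∪ ((A ∪ B) \ Y)))).card := by
    rw [← compl_eq_univ_sdiff, card_compl]
    have h1 := card_insert_le y (Y ∪ ((A ∪ B) \ Y))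
    have h2 := card_union_le Y ((A ∪ B) \ Y)
    omega
  obtain ⟨Q, hQ, hQc⟩ := exists_subset_card_eq hcard
  have hQ' : ∀ z ∈ Q, z ≠ y ∧ z ∉ Y ∧ z ∉ A ∧ z ∉ B := by
    intro z hz
    have := (mem_sdiff.1 (hQ hz)).2
    simp only [mem_insert, mem_union, mem_sdiff] at this
    tauto
  have hPQ : Disjoint P Q := by
    rw [disjoint_left]
    exact fun z hz hzQ => (hQ' z hzQ).2.1 (hP2 hz)
  have hCY : (P ∪ Q) ∩ Y = P := by
    ext z
    have h1 := hQ' z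
    have h2 := @hP2 z
    simp only [mem_inter, mem_union]
    tauto
  have hinter : ∀ D : Finset α, (A ∩ B ⊆ D) → (∀ z ∈ Q, z ∉ D) → (D ∩ Y).card = t + r →
      (D ∩ (P ∪ Q)).card = t := by
    intro D hD hDQ hDY
    have h1 : D ∩ (P ∪ Q) = (D ∩ Y) ∩ P := by
      ext z
      have h1 := hDQ z
      have h2 := @hP2 z
      simp only [mem_inter, mem_union]
      tauto
    have h2 : (D ∩ Y) ∪ P = Y := by
      ext z
      have h2 := @hP2 z
      have h3 := @hP1 z
      have h4 := @hD z
      simp only [mem_inter, mem_union, mem_insert, mem_sdiff] at h2 h3 h4 ⊢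
      tauto
    have h3 := card_union_add_card_inter (D ∩ Y) P
    rw [h2] at h3
    rw [h1]
    omega
  refine ⟨P ∪ Q, ⟨?_, ?_, ?_, by rw [hCY, hPc]⟩, ?_, ?_⟩
  · rw [card_union_of_disjoint hPQ]
    omega
  · exact mem_union_left _ (hP1 (mem_insert_self _ _))
  · rw [mem_union]
    rintro (h | h)
    · exact hyY (hP2 h)
    · exact (hQ' y h).1 rfl
  · exact hinter A inter_subset_left (fun z hz => (hQ' z hz).2.2.1) hAY
  · exact hinter B inter_subset_right (fun z hz => (hQ' z hz).2.2.2) hBY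

theorem card_repl_sdiff {A B : Finset α} {u v : α} (huA : u ∈ A) (huB : u ∉ B) (hvB : v ∈ B) :
    (insert v (A.erase u) \ B).card + 1 = (A \ B).card := by
  have hu : u ∈ A \ B := mem_sdiff.2 ⟨huA, huB⟩
  have : insert v (A.erase u) \ B = (A \ B).erase u := by
    ext z
    simp only [mem_insert, mem_erase, mem_sdiff]
    constructor
    · rintro ⟨rfl | h, h'⟩
      · exact absurd hvB h'
      · tauto
    · tauto
  rw [this, card_erase_of_mem hu]
  have : 0 < (A \ B).card := card_pos.2 ⟨u, hu⟩
  omega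

/-- One swap moves a slice closer to another slice $B$ while remaining a slice. Here the traces on
$Y$ agree and the swap is outside $Y$; `exists_step_inside` covers the other case. The remaining
conclusions supply the room needed for a common neighbour. -/
theorem exists_step_outside {k c : ℕ} {Y A B : Finset α} {x y : α} (hxY : x ∈ Y)
    (hA : IsSlice k c Y x y A) (hB : IsSlice k c Y x y B) (hAB : (A \ B).Nonempty)
    (hsub : A ∩ Y ⊆ B) :
    ∃ A', IsSlice k c Y x y A' ∧ (A' \ B).card + 1 = (A \ B).card ∧ Y \ (A ∩ A') = Y \ A ∧
      ((A ∪ A') \ Y).card ≤ (A \ Y).card + 1 ∧ (A \ Y).Nonempty := by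
  have hAt := hA.trace
  have hBt := hB.trace
  have hAk := hA.card
  have hBk := hB.card
  have heq : A ∩ Y = B ∩ Y := eq_of_subset_of_card_le
    (fun z hz => mem_inter.2 ⟨hsub hz, (mem_inter.1 hz).2⟩) (by omega)
  obtain ⟨u, hu⟩ := hAB
  obtain ⟨huA, huB⟩ := mem_sdiff.1 hu
  have huY : u ∉ Y := fun h => huB (hsub (mem_inter.2 ⟨huA, h⟩))
  obtain ⟨v, hvB, hvA⟩ : ∃ v ∈ B, v ∉ A := by
    by_contra hcon
    push Not at hcon
    rw [eq_of_subset_of_card_le hcon (by omega)] at huB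
    exact huB huA
  have hvY : v ∉ Y := fun h => hvA (mem_inter.1 (heq ▸ mem_inter.2 ⟨hvB, h⟩)).1
  have hsame : insert v (A.erase u) ∩ Y = A ∩ Y := by
    ext z
    simp only [mem_insert, mem_erase, mem_inter]
    constructor
    · rintro ⟨rfl | h, h'⟩
      · exact absurd h' hvY
      · tauto
    · rintro ⟨h, h'⟩
      exact ⟨Or.inr ⟨fun h2 => huY (h2 ▸ h'), h⟩, h'⟩
  refine ⟨insert v (A.erase u), ⟨(card_repl huA hvA).trans hAk, ?_, ?_, by rw [hsame, hAt]⟩,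
    card_repl_sdiff huA huB hvB, ?_, ?_, ⟨u, mem_sdiff.2 ⟨huA, huY⟩⟩⟩
  · exact mem_insert_of_mem (mem_erase.2 ⟨fun h => huY (h ▸ hxY), hA.mem⟩)
  · simp only [mem_insert, mem_erase, not_or]
    exact ⟨fun h => hB.notMem (h ▸ hvB), fun h => hA.notMem h.2⟩
  · ext z
    have := Finset.ext_iff.1 hsame z
    simp only [mem_inter, mem_sdiff] at this ⊢
    tauto
  · refine le_trans (card_le_card (t := insert v (A \ Y)) ?_) (card_insert_le _ _)
    intro z hz
    simp only [mem_insert, mem_erase, mem_sdiff, mem_union] at hz ⊢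
    tauto

theorem exists_step_inside {k c : ℕ} {Y A B : Finset α} {x y : α}
    (hA : IsSlice k c Y x y A) (hB : IsSlice k c Y x y B) (hsub : ¬ A ∩ Y ⊆ B) :
    ∃ A', IsSlice k c Y x y A' ∧ (A' \ B).card + 1 = (A \ B).card ∧
      (Y \ (A ∩ A')).card ≤ (Y \ A).card + 1 ∧ (A ∪ A') \ Y = A \ Y ∧ (Y \ A).Nonempty := by
  have hAt := hA.trace
  have hBt := hB.trace
  obtain ⟨u, hu, huB⟩ := not_subset.1 hsub
  obtain ⟨huA, huY⟩ := mem_inter.1 hu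
  obtain ⟨v, hv, hvA⟩ : ∃ v ∈ B ∩ Y, v ∉ A := by
    by_contra hcon
    push Not at hcon
    have := eq_of_subset_of_card_le (s := B ∩ Y) (t := A ∩ Y)
      (fun z hz => mem_inter.2 ⟨hcon z hz, (mem_inter.1 hz).2⟩) (by omega)
    rw [← this] at hu
    exact huB (mem_inter.1 hu).1
  obtain ⟨hvB, hvY⟩ := mem_inter.1 hv
  have hcY : (insert v (A.erase u) ∩ Y).card = c := by
    have : insert v (A.erase u) ∩ Y = insert v ((A ∩ Y).erase u) := by
      ext z
      simp only [mem_insert, mem_erase, mem_inter]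
      constructor
      · tauto
      · rintro (rfl | h)
        · exact ⟨Or.inl rfl, hvY⟩
        · tauto
    rw [this, card_repl hu (fun h => hvA (mem_inter.1 h).1), hAt]
  refine ⟨insert v (A.erase u), ⟨(card_repl huA hvA).trans hA.card, ?_, ?_, hcY⟩,
    card_repl_sdiff huA huB hvB, ?_, ?_, ⟨v, mem_sdiff.2 ⟨hvY, hvA⟩⟩⟩
  · exact mem_insert_of_mem (mem_erase.2 ⟨fun h => huB (h ▸ hB.mem), hA.mem⟩)
  · simp only [mem_insert, mem_erase, not_or]
    exact ⟨fun h => hB.notMem (h ▸ hvB), fun h => hA.notMem h.2⟩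
  · refine le_trans (card_le_card (t := insert u (Y \ A)) ?_) (card_insert_le _ _)
    intro z hz
    simp only [mem_insert, mem_erase, mem_sdiff, mem_inter] at hz ⊢
    tauto
  · ext z
    simp only [mem_insert, mem_erase, mem_sdiff, mem_union]
    constructor
    · rintro ⟨h | rfl | h, h'⟩
      · exact ⟨h, h'⟩
      · exact absurd hvY h'
      · exact ⟨h.2, h'⟩
    · tauto

/-- A property of slices that is transferred along pairs sharing exactly `t` elements to its
negation, and back, is shared by all slices or by none. -/
theorem forall_of_alternating {k t r : ℕ} {Y : Finset α} {x y : α} (p : Finset α → Prop)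
    (hY : Y.card = t + 2 * r) (hr : t + r ≤ k) (hxY : x ∈ Y) (hyY : y ∉ Y)
    (hn : 2 * k + 1 ≤ Fintype.card α + t) (hk : t + r = k ∨ 2 * k + 2 ≤ Fintype.card α + t)
    (ht : r = 0 ∨ 2 ≤ t) (ht1 : 1 ≤ t)
    (hp : ∀ A C : Finset α, IsSlice k (t + r) Y x y A → IsSlice k (t + r) Y x y C →
      (A ∩ C).card = t → p A → p C) :
    ∀ A B : Finset α, IsSlice k (t + r) Y x y A → IsSlice k (t + r) Y x y B → p A → p B := by
  -- Close slices have a common neighbour, so the property passes between them in two transfers.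
  have step : ∀ A B : Finset α, IsSlice k (t + r) Y x y A → IsSlice k (t + r) Y x y B →
      (Y \ (A ∩ B)).card + 1 ≤ t + r →
      t + 2 * r + 1 + ((A ∪ B) \ Y).card + (k - t - r) ≤ Fintype.card α → p A → p B := by
    intro A B hA hB hin hout hpA
    obtain ⟨C, hC, hAC, hBC⟩ :=
      exists_common_neighbour hY hr hxY hyY hA.trace hB.trace hin hout
    refine hp C B hC hB ?_ (hp A C hA hC hAC hpA)
    rwa [inter_comm]
  have key : ∀ d, ∀ A B : Finset α, (A \ B).card = d → IsSlice k (t + r) Y x y A →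
      IsSlice k (t + r) Y x y B → p A → p B := by
    intro d
    induction d with
    | zero =>
      intro A B hd hA hB hpA
      have : A = B := eq_of_subset_of_card_le (sdiff_eq_empty_iff_subset.1 (card_eq_zero.1 hd))
        (by rw [hA.card, hB.card])
      exact this ▸ hpA
    | succ d ih =>
      intro A B hd hA hB hpA
      have h1 := card_inter_add_card_sdiff A Y
      have h2 := card_inter_add_card_sdiff Y A
      rw [inter_comm, hA.trace, hY] at h2
      rw [hA.trace, hA.card] at h1
      by_cases hsub : A ∩ Y ⊆ B
      · obtain ⟨A', hA', hd', hin, hout, hne⟩ :=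
          exists_step_outside hxY hA hB (card_pos.1 (by omega)) hsub
        have := card_pos.2 hne
        exact ih A' B (by omega) hA' hB (step A A' hA hA' (by rw [hin]; omega) (by omega) hpA)
      · obtain ⟨A', hA', hd', hin, hout, hne⟩ := exists_step_inside hA hB hsub
        have := card_pos.2 hne
        exact ih A' B (by omega) hA' hB (step A A' hA hA' (by omega) (by rw [hout]; omega) hpA)
  exact fun A B => key _ A B rfl

theorem of_notMem_shift {F : Finset (Finset α)} {x y : α} {A : Finset α} (hA : A ∈ F)
    (hn : A ∉ shift F x y) :
    y ∈ A ∧ x ∉ A ∧ insert x (A.erase y) ∉ F ∧ insert x (A.erase y) ∈ shift F x y := by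
  rw [mem_shift] at hn
  have hy : y ∈ A := by
    by_contra hy
    exact hn (Or.inl ⟨hA, fun h => absurd h hy⟩)
  have hx : x ∉ A := fun hx => hn (Or.inl ⟨hA, fun _ h => absurd hx h⟩)
  have hm : insert x (A.erase y) ∉ F := fun hm => hn (Or.inl ⟨hA, fun _ _ => hm⟩)
  refine ⟨hy, hx, hm, mem_shift.2 (Or.inr ⟨hm, mem_insert_self _ _, notMem_repl hy hx, ?_⟩)⟩
  rwa [repl_repl hy hx]

theorem exists_isSlice {k t r : ℕ} {Y : Finset α} {x y : α} (hY : Y.card = t + 2 * r)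
    (hr : t + r ≤ k) (ht : 1 ≤ t) (hn : 2 * k + 1 ≤ Fintype.card α + t) (hxY : x ∈ Y)
    (hyY : y ∉ Y) : ∃ A, IsSlice k (t + r) Y x y A := by
  obtain ⟨P, hP1, hP2, hPc⟩ := exists_subsuperset_card_eq (s := {x}) (t := Y)
    (n := t + r) (singleton_subset_iff.2 hxY) (by rw [card_singleton]; omega) (by omega)
  have hcard : k - t - r ≤ (univ \ (insert y Y)).card := by
    rw [← compl_eq_univ_sdiff, card_compl]
    have h1 := card_insert_le y Y
    omega
  obtain ⟨Q, hQ, hQc⟩ := exists_subset_card_eq hcard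
  have hQ' : ∀ z ∈ Q, z ≠ y ∧ z ∉ Y := by
    intro z hz
    have := (mem_sdiff.1 (hQ hz)).2
    simp only [mem_insert] at this
    tauto
  refine ⟨P ∪ Q, ?_, mem_union_left _ (hP1 (mem_singleton_self x)), ?_, ?_⟩
  · rw [card_union_of_disjoint]
    · omega
    · rw [disjoint_left]
      exact fun z hz hzQ => (hQ' z hzQ).2 (hP2 hz)
  · rw [mem_union]
    rintro (h | h)
    · exact hyY (hP2 h)
    · exact (hQ' y h).1 rfl
  · rw [← hPc]
    congr 1
    ext z
    have h1 := hQ' z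
    have h2 := @hP2 z
    simp only [mem_inter, mem_union]
    tauto

/-- If a shift of a `t`-intersecting family has a center, then so does the family. -/
theorem exists_center_of_shift {k t r : ℕ} {F : Finset (Finset α)} {Y : Finset α} {x y : α}
    (hF : ∀ A ∈ F, A.card = k) (hFt : TInt t F) (hxy : x ≠ y) (hY : Y.card = t + 2 * r)
    (hr : t + r ≤ k) (hn : 2 * k + 1 ≤ Fintype.card α + t)
    (hk : t + r = k ∨ 2 * k + 2 ≤ Fintype.card α + t) (ht : r = 0 ∨ 2 ≤ t) (ht1 : 1 ≤ t)
    (hS : shift F x y = centerFamily k (t + r) Y) :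
    ∃ Y' : Finset α, Y'.card = t + 2 * r ∧ ∀ A ∈ F, t + r ≤ (A ∩ Y').card := by
  have hmem : ∀ A ∈ shift F x y, t + r ≤ (A ∩ Y).card := fun A hA =>
    (mem_centerFamily.1 (hS ▸ hA)).2
  by_cases hxY : x ∈ Y <;> by_cases hyY : y ∈ Y
  · refine ⟨Y, hY, fun A hA => ?_⟩
    by_cases hAS : A ∈ shift F x y
    · exact hmem A hAS
    · obtain ⟨hy, hx, -, hm⟩ := of_notMem_shift hA hAS
      have h := hmem _ hm
      have : insert x (A.erase y) ∩ Y = insert x ((A ∩ Y).erase y) := by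
        ext z
        simp only [mem_insert, mem_erase, mem_inter]
        constructor
        · tauto
        · rintro (rfl | h)
          · exact ⟨Or.inl rfl, hxY⟩
          · tauto
      rwa [this, card_repl (mem_inter.2 ⟨hy, hyY⟩) (fun h => hx (mem_inter.1 h).1)] at h
  -- The only case in which the center may move: every slice comes from `F` either unchanged or with
  -- `x` in place of `y`.
  · have hback : ∀ C, IsSlice k (t + r) Y x y C → C ∈ F ∨ insert y (C.erase x) ∈ F := by
      intro C hC
      have : C ∈ shift F x y := by
        rw [hS]; exact mem_centerFamily.2 ⟨hC.card, hC.trace.ge⟩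
      rcases mem_shift.1 this with h | h
      · exact Or.inl h.1
      · exact Or.inr h.2.2.2
    -- If `A ∈ F` and `C` share exactly `t` points, one of them `x`, then `C - x + y` meets `A` in
    -- at most `t - 1` points; hence `C` itself is in `F`.
    have halt := forall_of_alternating (x := x) (y := y) (· ∈ F) hY hr hxY hyY hn hk ht ht1 (by
      intro A C hA hC hAC hAF
      refine (hback C hC).resolve_right fun hCF => ?_
      have h1 := hFt _ hAF _ hCF
      have h2 : A ∩ insert y (C.erase x) ⊆ (A ∩ C).erase x := by
        intro z hz
        simp only [mem_insert, mem_erase, mem_inter] at hz ⊢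
        rcases hz with ⟨h, rfl | h'⟩
        · exact absurd h hA.notMem
        · tauto
      have h3 := card_le_card h2
      rw [card_erase_of_mem (mem_inter.2 ⟨hA.mem, hC.mem⟩)] at h3
      omega)
    by_cases hex : ∃ A, IsSlice k (t + r) Y x y A ∧ A ∈ F
    · obtain ⟨A₀, hA₀, hA₀F⟩ := hex
      refine ⟨Y, hY, fun A hA => ?_⟩
      by_cases hAS : A ∈ shift F x y
      · exact hmem A hAS
      · obtain ⟨hy, hx, hmF, hm⟩ := of_notMem_shift hA hAS
        have h := hmem _ hm
        have h1 := card_repl_inter (A := A) hyY hxY hx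
        by_contra hlt
        exact hmF (halt A₀ _ hA₀ ⟨(card_repl hy hx).trans (hF A hA), mem_insert_self _ _,
          notMem_repl hy hx, by omega⟩ hA₀F)
    -- No slice lies in `F`, so all of them were produced by the shift and the center of `F` is `Y -
    -- x + y`.
    · refine ⟨insert y (Y.erase x), by rw [card_repl hxY hyY, hY], fun A hA => ?_⟩
      by_cases hAS : A ∈ shift F x y
      · have h := hmem A hAS
        by_cases hx : x ∈ A
        · have hxAY : x ∈ A ∩ Y := mem_inter.2 ⟨hx, hxY⟩
          by_cases hy : y ∈ A
          · have : A ∩ insert y (Y.erase x) = insert y ((A ∩ Y).erase x) := by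
              ext z
              simp only [mem_insert, mem_erase, mem_inter]
              constructor
              · tauto
              · rintro (rfl | h)
                · exact ⟨hy, Or.inl rfl⟩
                · tauto
            rw [this, card_repl hxAY (fun h => hyY (mem_inter.1 h).2)]
            exact h
          · have hne : (A ∩ Y).card ≠ t + r := fun h => hex ⟨A, ⟨hF A hA, hx, hy, h⟩, hA⟩
            have h1 : (A ∩ Y).erase x ⊆ A ∩ insert y (Y.erase x) := by
              intro z hz
              simp only [mem_insert, mem_erase, mem_inter] at hz ⊢
              tauto
            have h2 := card_le_card h1
            rw [card_erase_of_mem hxAY] at h2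
            omega
        · refine h.trans (card_le_card fun z hz => ?_)
          simp only [mem_insert, mem_erase, mem_inter] at hz ⊢
          exact ⟨hz.1, Or.inr ⟨fun h => hx (h ▸ hz.1), hz.2⟩⟩
      · obtain ⟨hy, hx, hmF, hm⟩ := of_notMem_shift hA hAS
        have h := hmem _ hm
        rw [card_repl_inter hyY hxY hx,
          ← card_insert_of_notMem (a := y) (fun h => hyY (mem_inter.1 h).2)] at h
        refine h.trans (card_le_card fun z hz => ?_)
        simp only [mem_insert, mem_erase, mem_inter] at hz ⊢
        rcases hz with rfl | hz
        · exact ⟨hy, Or.inl rfl⟩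
        · exact ⟨hz.1, Or.inr ⟨fun h => hx (h ▸ hz.1), hz.2⟩⟩
  -- This case is impossible: the shift contains a slice through `y`, hence also its image with `x`
  -- for `y`, whose trace on `Y` is one too small.
  · obtain ⟨A, hA⟩ := exists_isSlice (x := y) (y := x) hY hr ht1 hn hyY hxY
    have hAS : A ∈ shift F x y := by
      rw [hS]; exact mem_centerFamily.2 ⟨hA.card, hA.trace.ge⟩
    have hy := hA.mem
    have hx := hA.notMem
    have hmF : insert x (A.erase y) ∈ F := by
      rcases mem_shift.1 hAS with h | h
      · exact h.2 hy hx
      · exact absurd h.2.1 hx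
    have h := hmem _ (mem_shift.2 (Or.inl ⟨hmF, fun h => absurd h (notMem_repl hy hx)⟩))
    have h1 : insert x (A.erase y) ∩ Y ⊆ (A ∩ Y).erase y := by
      intro z hz
      simp only [mem_insert, mem_erase, mem_inter] at hz ⊢
      rcases hz with ⟨rfl | h, h'⟩
      · exact absurd h' hxY
      · tauto
    have h2 := card_le_card h1
    rw [card_erase_of_mem (mem_inter.2 ⟨hy, hyY⟩), hA.trace] at h2
    omega
  · refine ⟨Y, hY, fun A hA => ?_⟩
    by_cases hAS : A ∈ shift F x y
    · exact hmem A hAS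
    · obtain ⟨hy, hx, -, hm⟩ := of_notMem_shift hA hAS
      refine (hmem _ hm).trans (card_le_card fun z hz => ?_)
      simp only [mem_insert, mem_erase, mem_inter] at hz ⊢
      rcases hz with ⟨rfl | h, h'⟩
      · exact absurd h' hxY
      · tauto

/-! ### The complete intersection theorem for arbitrary maximum families -/

/-- The total label of a family. -/
def potential (f : α → ℕ) (F : Finset (Finset α)) : ℕ := ∑ A ∈ F, ∑ z ∈ A, f z

theorem potential_shift_lt {F : Finset (Finset α)} {f : α → ℕ} {x y : α} (hf : f x < f y)
    (hnot : ¬ ReplClosed F y x) : potential f (shift F x y) < potential f F := by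
  have hmove : ∀ A : Finset α, y ∈ A → x ∉ A →
      ∑ z ∈ insert x (A.erase y), f z < ∑ z ∈ A, f z := by
    intro A hy hx
    rw [sum_insert (fun h => hx (mem_of_mem_erase h)), ← sum_erase_add A f hy]
    omega
  unfold potential shift
  rw [sum_image (shiftSet_injOn F x y)]
  unfold ReplClosed at hnot
  push Not at hnot
  obtain ⟨A, hA, hy, hx, hm⟩ := hnot
  refine sum_lt_sum (fun B _ => ?_) ⟨A, hA, ?_⟩
  · unfold shiftSet
    split_ifs with h
    · exact (hmove B h.1 h.2.1).le
    · exact le_rfl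
  · unfold shiftSet
    rw [if_pos ⟨hy, hx, hm⟩]
    exact hmove A hy hx

/-- Induction on the total label, which every nontrivial compressing shift lowers. The side
conditions on $r$ and $n$ accompany the center because `exists_center_of_shift` needs them at each
step back. -/
theorem exists_center_of_lt {k t : ℕ} {F : Finset (Finset α)}
    (hmax : IsMaxTInt k t F) (ht : 1 ≤ t) (htk : t ≤ k)
    (hn : 2 * k + 1 ≤ Fintype.card α + t) (hne : t = 1 → 2 * k + 1 ≤ Fintype.card α) :
    ∃ r Y, t + r ≤ k ∧ Y.card = t + 2 * r ∧ (t + r = k ∨ 2 * k + 2 ≤ Fintype.card α + t) ∧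
      (r = 0 ∨ 2 ≤ t) ∧ ∀ A ∈ F, t + r ≤ (A ∩ Y).card := by
  obtain ⟨f, hf⟩ : ∃ f : α → ℕ, IsLabel f :=
    ⟨fun x => (Fintype.equivFin α x).val,
      fun x y h => (Fintype.equivFin α).injective (Fin.val_injective h),
      fun x => (Fintype.equivFin α x).isLt⟩
  obtain ⟨N, hN⟩ : ∃ N, N = potential f F := ⟨_, rfl⟩
  induction N using Nat.strong_induction_on generalizing F with
  | _ N ih =>
    by_cases hc : Compressed f F
    · exact exists_center_of_compressed hf hmax hc ht htk hn hne
    · unfold Compressed at hc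
      push Not at hc
      obtain ⟨x, y, hxy, hnot⟩ := hc
      obtain ⟨r, Y, hr, hY, hk, ht2, hY'⟩ :=
        ih _ (hN ▸ potential_shift_lt hxy hnot) (hmax.shift x y) rfl
      obtain ⟨Y', hY'c, hF⟩ := exists_center_of_shift hmax.sized hmax.tint
        (fun h => by rw [h] at hxy; exact lt_irrefl _ hxy) hY hr hn hk ht2 ht
        ((hmax.shift x y).eq_centerFamily hY hY')
      exact ⟨r, Y', hr, hY'c, hk, ht2, hF⟩

/-- **Ahlswede–Khachatryan complete intersection theorem** with uniqueness. -/
theorem exists_eq_centerFamily {k t : ℕ} {F : Finset (Finset α)}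
    (hmax : IsMaxTInt k t F) (ht : 1 ≤ t) (htk : t ≤ k)
    (hn : 2 * k ≤ Fintype.card α + t) (hne : ¬ (Fintype.card α = 2 * k ∧ t = 1)) :
    ∃ r Y, t + r ≤ k ∧ Y.card = t + 2 * r ∧ F = centerFamily k (t + r) Y := by
  rcases hn.eq_or_lt with h | h
  -- At the boundary `n = 2 * k - t` any two `k`-sets share `t` points, so the family consists of
  -- all `k`-sets.
  · refine ⟨k - t, univ, by omega, by rw [card_univ]; omega, ?_⟩
    refine hmax.eq_centerFamily (by rw [card_univ]; omega) fun A hA => ?_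
    rw [inter_univ, hmax.sized A hA]
    omega
  · obtain ⟨r, Y, hr, hY, -, -, hF⟩ := exists_center_of_lt hmax ht htk h (by omega)
    exact ⟨r, Y, hr, hY, hmax.eq_centerFamily hY hF⟩

theorem exists_isMaxTInt (k t : ℕ) : ∃ F : Finset (Finset α), IsMaxTInt k t F := by
  classical
  obtain ⟨F, hF, hFmax⟩ := exists_max_image
    ((univ : Finset (Finset (Finset α))).filter fun F => (∀ A ∈ F, A.card = k) ∧ TInt t F)
    card ⟨∅, mem_filter.2 ⟨mem_univ _, by simp [TInt]⟩⟩
  simp only [mem_filter, mem_univ, true_and] at hF hFmax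
  exact ⟨F, hF.1, hF.2, fun G hG hGt => hFmax G ⟨hG, hGt⟩⟩

end Intersecting

/-! ### Transfer to a subset of a larger ground set -/

section Lift

variable {α β : Type*} [Fintype α] [DecidableEq α] [DecidableEq β]

/-- The image of a family under an embedding of the ground set. -/
def lift (g : α ↪ β) (F : Finset (Finset α)) : Finset (Finset β) := F.image (fun A => A.map g)

theorem card_lift (g : α ↪ β) (F : Finset (Finset α)) : (lift g F).card = F.card :=
  card_image_of_injective _ (map_injective g)

theorem map_mem_lift {g : α ↪ β} {F : Finset (Finset α)} {A : Finset α} :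
    A.map g ∈ lift g F ↔ A ∈ F := by
  unfold lift
  rw [mem_image]
  refine ⟨fun ⟨B, hB, h⟩ => map_injective g h ▸ hB, fun h => ⟨A, h, rfl⟩⟩

theorem card_map_inter_map (g : α ↪ β) (A B : Finset α) :
    (A.map g ∩ B.map g).card = (A ∩ B).card := by
  rw [← map_inter, card_map]

/-- A `t`-intersecting family of `s`-subsets of `V` that is at least as large as every such family
on a ground set of the same size consists of the `s`-subsets sharing `t + r` elements with some
`Y` of size `t + 2r`. -/
theorem exists_center_on {s t : ℕ} {g : α ↪ β} {V : Finset β} (hV : univ.map g = V)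
    {T₀ : Finset (Finset α)} (hT₀ : IsMaxTInt s t T₀) {T : Finset (Finset β)}
    (hT : T ⊆ powersetCard s V) (hTt : TInt t T) (hle : T₀.card ≤ T.card)
    (ht : 1 ≤ t) (hts : t ≤ s) (hn : 2 * s ≤ Fintype.card α + t)
    (hne : ¬ (Fintype.card α = 2 * s ∧ t = 1)) :
    ∃ r Y, t + r ≤ s ∧ Y ⊆ V ∧ Y.card = t + 2 * r ∧
      T = (powersetCard s V).filter (fun S => t + r ≤ (S ∩ Y).card) := by
  obtain ⟨T', hT'⟩ : ∃ T' : Finset (Finset α), lift g T' = T := by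
    refine ⟨univ.filter (fun A => A.map g ∈ T), ?_⟩
    ext S
    unfold lift
    simp only [mem_image, mem_filter, mem_univ, true_and]
    constructor
    · rintro ⟨A, hA, rfl⟩; exact hA
    · intro hS
      have hSV := (mem_powersetCard.1 (hT hS)).1
      rw [← hV] at hSV
      obtain ⟨A, -, rfl⟩ := subset_map_iff.1 hSV
      exact ⟨A, hS, rfl⟩
  have hmax : IsMaxTInt s t T' := by
    refine ⟨?_, ?_, ?_⟩
    · intro A hA
      have := (mem_powersetCard.1 (hT (hT' ▸ map_mem_lift.2 hA))).2
      rwa [card_map] at this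
    · intro A hA B hB
      rw [← card_map_inter_map g]
      exact hTt _ (hT' ▸ map_mem_lift.2 hA) _ (hT' ▸ map_mem_lift.2 hB)
    · intro G hG hGt
      refine (hT₀.le_card G hG hGt).trans (hle.trans ?_)
      rw [← hT', card_lift]
  obtain ⟨r, Y, hr, hY, hTY⟩ := exists_eq_centerFamily hmax ht hts hn hne
  refine ⟨r, Y.map g, hr, hV ▸ map_subset_map.2 (subset_univ _), by rw [card_map, hY], ?_⟩
  ext S
  constructor
  · intro hS
    refine mem_filter.2 ⟨hT hS, ?_⟩
    rw [← hT'] at hS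
    obtain ⟨A, hA, rfl⟩ := mem_image.1 hS
    rw [card_map_inter_map]
    rw [hTY] at hA
    exact (mem_centerFamily.1 hA).2
  · intro hS
    obtain ⟨hS, hSY⟩ := mem_filter.1 hS
    obtain ⟨hSV, hSs⟩ := mem_powersetCard.1 hS
    rw [← hV] at hSV
    obtain ⟨A, -, rfl⟩ := subset_map_iff.1 hSV
    rw [card_map_inter_map] at hSY
    rw [card_map] at hSs
    rw [← hT', map_mem_lift, hTY]
    exact mem_centerFamily.2 ⟨hSs, hSY⟩

end Lift

/-! ### Growth of binomial coefficients -/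

section Numbers

theorem choose_add_le (N q d : ℕ) :
    (N + q).choose (d + 1) ≤ N.choose (d + 1) + q * (N + q) ^ d := by
  induction q with
  | zero => simp
  | succ q ih =>
    rw [← add_assoc, Nat.choose_succ_succ']
    have h1 : (N + q).choose d ≤ (N + q + 1) ^ d :=
      (Nat.choose_le_pow _ _).trans (Nat.pow_le_pow_left (by omega) _)
    have h2 : q * (N + q) ^ d ≤ q * (N + q + 1) ^ d :=
      Nat.mul_le_mul_left _ (Nat.pow_le_pow_left (by omega) _)
    rw [add_mul]
    omega

theorem exists_mul_pow_lt_choose (C k d : ℕ) :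
    ∃ n₀, ∀ n, n₀ ≤ n → C * n ^ d < (n - k).choose (d + 1) := by
  refine ⟨2 * k + 2 * d + 2 ^ (d + 1) * (d + 1).factorial * C + 1, fun n hn => ?_⟩
  have h1 := Nat.pow_sub_le_descFactorial (n - k) (d + 1)
  rw [Nat.descFactorial_eq_factorial_mul_choose] at h1
  have h2 : n ^ (d + 1) ≤ 2 ^ (d + 1) * (n - k + 1 - (d + 1)) ^ (d + 1) := by
    rw [← mul_pow]
    exact Nat.pow_le_pow_left (by omega) _
  have h3 : n ^ (d + 1) ≤ (2 ^ (d + 1) * (d + 1).factorial) * (n - k).choose (d + 1) := by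
    rw [mul_assoc]
    exact h2.trans (Nat.mul_le_mul_left _ h1)
  refine Nat.lt_of_mul_lt_mul_left (a := 2 ^ (d + 1) * (d + 1).factorial) (lt_of_lt_of_le ?_ h3)
  rw [pow_succ n d, mul_comm (n ^ d) n, ← mul_assoc]
  exact Nat.mul_lt_mul_of_pos_right (by omega) (Nat.pow_pos (by omega))

/-- The difference $\binom{n-s}{k-s} - \binom{n-k}{k-s}$ is $O(n^{k-s-1})$ and $M \le \binom ks$, so
one extra $\binom{n-k}{k-s}$ of order $n^{k-s}$ absorbs it along with the two error terms, one for
each family. -/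
theorem exists_main_term_dominates {k s : ℕ} (hsk : s < k) :
    ∃ n₀, k ≤ n₀ ∧ ∀ n, n₀ ≤ n → ∀ M, 1 ≤ M → M ≤ k.choose s →
      (M - 1) * (n - s).choose (k - s) + 2 * (k.choose s * (k * n ^ (k - s - 1)))
        < M * (n - k).choose (k - s) := by
  obtain ⟨d, hd⟩ : ∃ d, k - s = d + 1 := ⟨k - s - 1, by omega⟩
  obtain ⟨n₀, h₀⟩ := exists_mul_pow_lt_choose (3 * (k.choose s * k)) k d
  refine ⟨n₀ + k, by omega, fun n hn M hM hMk => ?_⟩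
  have h1 := h₀ n (by omega)
  rw [hd, show d + 1 - 1 = d by omega]
  have h2 := choose_add_le (n - k) (k - s) d
  rw [show n - k + (k - s) = n - s by omega] at h2
  have h3 : (n - s) ^ d ≤ n ^ d := Nat.pow_le_pow_left (by omega) _
  obtain ⟨M', rfl⟩ : ∃ M', M = M' + 1 := ⟨M - 1, by omega⟩
  rw [show M' + 1 - 1 = M' by omega]
  have h4 : (k - s) * (n - s) ^ d ≤ k * n ^ d := Nat.mul_le_mul (by omega) h3
  have h5 : M' * (n - s).choose (d + 1) ≤ M' * ((n - k).choose (d + 1) + k * n ^ d) :=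
    Nat.mul_le_mul_left _ (by omega)
  have h6 : M' * (k * n ^ d) ≤ k.choose s * (k * n ^ d) := Nat.mul_le_mul_right _ (by omega)
  nlinarith

end Numbers

/-! ### Heavy sets -/

section Heavy

variable {α : Type*} [Fintype α] [DecidableEq α]

/-- The `s`-sets contained in many members of the family. -/
def heavy (k s : ℕ) (F : Finset (Finset α)) : Finset (Finset α) :=
  (powersetCard s univ).filter
    (fun S => k * Fintype.card α ^ (k - s - 1) < (F.filter (fun A => S ⊆ A)).card)

theorem card_supersets {k : ℕ} {S : Finset α} (hS : S.card ≤ k) :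
    ((powersetCard k univ).filter (fun A => S ⊆ A)).card
      = (Fintype.card α - S.card).choose (k - S.card) := by
  rw [← card_trace_eq (Subset.refl S) hS]
  congr 1
  ext A
  simp only [mem_filter, inter_eq_right]

/-- A member containing $S$ and meeting $Z \setminus S$ contains one of at most $k$ sets of size
$s+1$, each in at most $n^{k-s-1}$ sets of size $k$. The threshold in `heavy` is chosen to exceed
this. -/
theorem exists_inter_subset_of_heavy {k s : ℕ} {F : Finset (Finset α)} {S Z : Finset α}
    (hF : ∀ A ∈ F, A.card = k) (hsk : s < k) (hS : S ∈ heavy k s F) (hZ : Z.card ≤ k) :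
    ∃ A ∈ F, A ∩ Z ⊆ S := by
  obtain ⟨hSs, hdeg⟩ := mem_filter.1 hS
  have hSc := (mem_powersetCard.1 hSs).2
  by_contra hcon
  push Not at hcon
  have hsub : F.filter (fun A => S ⊆ A) ⊆
      (Z \ S).biUnion (fun z => (powersetCard k univ).filter (fun A => insert z S ⊆ A)) := by
    intro A hA
    obtain ⟨hAF, hSA⟩ := mem_filter.1 hA
    obtain ⟨z, hz, hzS⟩ := not_subset.1 (hcon A hAF)
    obtain ⟨hzA, hzZ⟩ := mem_inter.1 hz
    exact mem_biUnion.2 ⟨z, mem_sdiff.2 ⟨hzZ, hzS⟩, mem_filter.2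
      ⟨mem_powersetCard.2 ⟨subset_univ _, hF A hAF⟩, insert_subset hzA hSA⟩⟩
  have h1 := card_le_card hsub
  have h2 : ((Z \ S).biUnion
      (fun z => (powersetCard k univ).filter (fun A => insert z S ⊆ A))).card
      ≤ (Z \ S).card * Fintype.card α ^ (k - s - 1) := by
    refine card_biUnion_le_card_mul _ _ _ fun z hz => ?_
    have hc : (insert z S).card = s + 1 := by
      rw [card_insert_of_notMem (mem_sdiff.1 hz).2, hSc]
    rw [card_supersets (by omega), hc]
    exact (Nat.choose_le_pow _ _).trans (Nat.pow_le_pow_left (by omega) _)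
  have h3 : (Z \ S).card ≤ k := (card_le_card sdiff_subset).trans hZ
  have h4 := Nat.mul_le_mul_right (Fintype.card α ^ (k - s - 1)) h3
  omega

theorem le_card_inter_of_heavy {k s c : ℕ} {F : Finset (Finset α)} {S Z : Finset α}
    (hF : ∀ A ∈ F, A.card = k) (hsk : s < k) (hS : S ∈ heavy k s F) (hZ : Z.card ≤ k)
    (h : ∀ A ∈ F, c ≤ (A ∩ Z).card) : c ≤ (S ∩ Z).card := by
  obtain ⟨A, hA, hAZ⟩ := exists_inter_subset_of_heavy hF hsk hS hZ
  exact (h A hA).trans (card_le_card fun z hz => mem_inter.2 ⟨hAZ hz, (mem_inter.1 hz).2⟩)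

theorem card_of_mem_heavy {k s : ℕ} {F : Finset (Finset α)} {S : Finset α}
    (hS : S ∈ heavy k s F) : S.card = s :=
  (mem_powersetCard.1 (mem_filter.1 hS).1).2

theorem tInt_heavy {k s t : ℕ} {F : Finset (Finset α)} (hF : ∀ A ∈ F, A.card = k)
    (hsk : s < k) (hFt : TInt t F) :
    (∀ S ∈ heavy k s F, ∀ A ∈ F, t ≤ (S ∩ A).card) ∧ TInt t (heavy k s F) := by
  have h1 : ∀ S ∈ heavy k s F, ∀ A ∈ F, t ≤ (S ∩ A).card := fun S hS A hA =>
    le_card_inter_of_heavy hF hsk hS (hF A hA).le fun B hB => hFt B hB A hA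
  refine ⟨h1, fun S hS S' hS' => ?_⟩
  refine le_card_inter_of_heavy hF hsk hS (by rw [card_of_mem_heavy hS']; omega) fun A hA => ?_
  rw [inter_comm]
  exact h1 S' hS' A hA

theorem subset_of_heavy {k s : ℕ} {F G : Finset (Finset α)} (hF : ∀ A ∈ F, A.card = k)
    (hG : ∀ B ∈ G, B.card = k) (hsk : s < k) (hFG : ∀ A ∈ F, ∀ B ∈ G, s ≤ (A ∩ B).card) :
    ∀ S ∈ heavy k s F, ∀ B ∈ G, S ⊆ B := by
  intro S hS B hB
  have := le_card_inter_of_heavy hF hsk hS (hG B hB).le fun A hA => hFG A hA B hB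
  rw [← inter_eq_left]
  exact eq_of_subset_of_card_le inter_subset_left (by rw [card_of_mem_heavy hS]; exact this)

/-- Each member contains an $s$-subset of $B$. If it is heavy, it accounts for at most
$\binom{n-s}{k-s}$ members; there are at most $\binom ks$ others, each below the threshold. -/
theorem card_le_of_cross {k s : ℕ} {F : Finset (Finset α)} {B : Finset α}
    (hF : ∀ A ∈ F, A.card = k) (hsk : s < k) (hB : B.card = k)
    (hFB : ∀ A ∈ F, s ≤ (A ∩ B).card) :
    F.card ≤ (heavy k s F).card * (Fintype.card α - s).choose (k - s)
      + k.choose s * (k * Fintype.card α ^ (k - s - 1)) := by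
  have hsub : F ⊆ (heavy k s F).biUnion
        (fun S => (powersetCard k univ).filter (fun A => S ⊆ A)) ∪
      (powersetCard s B \ heavy k s F).biUnion (fun S => F.filter (fun A => S ⊆ A)) := by
    intro A hA
    obtain ⟨S, hS, hSc⟩ := exists_subset_card_eq (hFB A hA)
    have hSA := hS.trans inter_subset_left
    by_cases hh : S ∈ heavy k s F
    · exact mem_union_left _ (mem_biUnion.2 ⟨S, hh, mem_filter.2
        ⟨mem_powersetCard.2 ⟨subset_univ _, hF A hA⟩, hSA⟩⟩)
    · exact mem_union_right _ (mem_biUnion.2 ⟨S, mem_sdiff.2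
        ⟨mem_powersetCard.2 ⟨hS.trans inter_subset_right, hSc⟩, hh⟩, mem_filter.2 ⟨hA, hSA⟩⟩)
  refine (card_le_card hsub).trans ((card_union_le _ _).trans (Nat.add_le_add ?_ ?_))
  · refine card_biUnion_le_card_mul _ _ _ fun S hS => ?_
    have hSc := card_of_mem_heavy hS
    rw [card_supersets (by omega), hSc]
  · refine (card_biUnion_le_card_mul _ _ (k * Fintype.card α ^ (k - s - 1)) ?_).trans
      (Nat.mul_le_mul_right _ ?_)
    · intro S hS
      obtain ⟨h1, h2⟩ := mem_sdiff.1 hS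
      by_contra hlt
      exact h2 (mem_filter.2 ⟨mem_powersetCard.2 ⟨subset_univ _, (mem_powersetCard.1 h1).2⟩,
        not_le.1 hlt⟩)
    · refine (card_le_card sdiff_subset).trans ?_
      rw [card_powersetCard, hB]

/-- If both families have heavy sets, every heavy set of one meets every heavy set of the other in
$s$ points, so all coincide and the total is at most 2. This is where $M \ge 3$ enters: in every
case a failure leaves at most $M-1$ heavy sets in total, too few for the lower bound. -/
theorem le_card_heavy_or {k s M : ℕ} {F G : Finset (Finset α)} (hF : ∀ A ∈ F, A.card = k)
    (hG : ∀ B ∈ G, B.card = k) (hFne : F.Nonempty) (hGne : G.Nonempty) (hsk : s < k)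
    (hFG : ∀ A ∈ F, ∀ B ∈ G, s ≤ (A ∩ B).card) (hM : 3 ≤ M)
    (hlarge : (M - 1) * (Fintype.card α - s).choose (k - s)
      + 2 * (k.choose s * (k * Fintype.card α ^ (k - s - 1)))
        < M * (Fintype.card α - k).choose (k - s))
    (hle : M * (Fintype.card α - k).choose (k - s) ≤ F.card + G.card) :
    M ≤ (heavy k s F).card ∨ M ≤ (heavy k s G).card := by
  have hGF : ∀ B ∈ G, ∀ A ∈ F, s ≤ (B ∩ A).card := fun B hB A hA => by
    rw [inter_comm]; exact hFG A hA B hB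
  obtain ⟨A₀, hA₀⟩ := hFne
  obtain ⟨B₀, hB₀⟩ := hGne
  have h1 := card_le_of_cross hF hsk (hG B₀ hB₀) fun A hA => hFG A hA B₀ hB₀
  have h2 := card_le_of_cross hG hsk (hF A₀ hA₀) fun B hB => hGF B hB A₀ hA₀
  by_contra hcon
  push Not at hcon
  have hsum : (heavy k s F).card + (heavy k s G).card ≤ M - 1 := by
    rcases (heavy k s F).eq_empty_or_nonempty with h0 | ⟨S, hS⟩
    · rw [h0, card_empty]; omega
    rcases (heavy k s G).eq_empty_or_nonempty with h0 | ⟨S', hS'⟩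
    · rw [h0, card_empty]; omega
    have heq : ∀ S ∈ heavy k s F, ∀ S' ∈ heavy k s G, S = S' := by
      intro S hS S' hS'
      have := le_card_inter_of_heavy (c := s) hG hsk hS' (Z := S)
        (by rw [card_of_mem_heavy hS]; omega) (fun B hB => by
          rw [inter_eq_right.2 (subset_of_heavy hF hG hsk hFG S hS B hB), card_of_mem_heavy hS])
      have h3 := eq_of_subset_of_card_le (inter_subset_left (s₁ := S') (s₂ := S))
        (by rw [card_of_mem_heavy hS']; exact this)
      exact (eq_of_subset_of_card_le (inter_eq_left.1 h3)
        (by rw [card_of_mem_heavy hS, card_of_mem_heavy hS'])).symm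
    have hF1 : (heavy k s F).card ≤ 1 := card_le_one.2 fun a ha b hb =>
      (heq a ha S' hS').trans (heq b hb S' hS').symm
    have hG1 : (heavy k s G).card ≤ 1 := card_le_one.2 fun a ha b hb =>
      (heq S hS a ha).symm.trans (heq S hS b hb)
    omega
  have h4 := Nat.mul_le_mul_right ((Fintype.card α - s).choose (k - s)) hsum
  rw [add_mul] at h4
  omega

end Heavy

/-! ### Permutations carrying a flag of sets to another -/

section Perm

variable {α : Type*} [Fintype α] [DecidableEq α]

theorem exists_perm_image {Y B Y' B' : Finset α} (hY : Y ⊆ B) (hY' : Y' ⊆ B')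
    (hYc : Y.card = Y'.card) (hBc : B.card = B'.card) :
    ∃ σ : Equiv.Perm α, Y.image σ = Y' ∧ B.image σ = B' := by
  have hcard : ∀ c : Bool × Bool,
      Fintype.card {a // (decide (a ∈ Y), decide (a ∈ B)) = c}
        = Fintype.card {a // (decide (a ∈ Y'), decide (a ∈ B')) = c} := by
    rintro ⟨b, c⟩
    rw [Fintype.card_subtype, Fintype.card_subtype]
    have e : ∀ Y B : Finset α, Y ⊆ B →
        (univ.filter fun a => (decide (a ∈ Y), decide (a ∈ B)) = (b, c)).card
          = if b then (if c then Y.card else 0)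
            else if c then B.card - Y.card else Fintype.card α - B.card := by
      intro Y B h
      cases b <;> cases c <;>
        simp only [Prod.mk.injEq, decide_eq_true_eq, decide_eq_false_iff_not, if_true, if_false,
          Bool.false_eq_true]
      · rw [← card_compl]
        congr 1
        ext a
        have := @h a
        simp only [mem_filter, mem_univ, true_and, mem_compl]
        tauto
      · rw [← card_sdiff_of_subset h]
        congr 1
        ext a
        simp only [mem_filter, mem_univ, true_and, mem_sdiff]
        tauto
      · rw [card_eq_zero, filter_eq_empty_iff]
        intro a _ ha
        exact ha.2 (h ha.1)
      · congr 1
        ext a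
        have := @h a
        simp only [mem_filter, mem_univ, true_and]
        tauto
    rw [e Y B hY, e Y' B' hY', hYc, hBc]
  let σ : Equiv.Perm α := Equiv.ofFiberEquiv fun c => Fintype.equivOfCardEq (hcard c)
  have hσ : ∀ a, (decide (σ a ∈ Y'), decide (σ a ∈ B')) = (decide (a ∈ Y), decide (a ∈ B)) :=
    fun a => Equiv.ofFiberEquiv_map (fun c => Fintype.equivOfCardEq (hcard c)) a
  have hσ1 : ∀ a, σ a ∈ Y' ↔ a ∈ Y := fun a => by
    have := congrArg Prod.fst (hσ a)
    simpa using this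
  have hσ2 : ∀ a, σ a ∈ B' ↔ a ∈ B := fun a => by
    have := congrArg Prod.snd (hσ a)
    simpa using this
  have himg : ∀ Z Z' : Finset α, (∀ a, σ a ∈ Z' ↔ a ∈ Z) → Z.image σ = Z' := by
    intro Z Z' h
    ext b
    rw [mem_image]
    constructor
    · rintro ⟨a, ha, rfl⟩; exact (h a).2 ha
    · intro hb
      obtain ⟨a, rfl⟩ := σ.surjective b
      exact ⟨a, (h a).1 hb, rfl⟩
  exact ⟨σ, himg _ _ hσ1, himg _ _ hσ2⟩

end Perm

/-! ### What a center family forces on sets that meet it or contain it -/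

section Center

variable {α : Type*} [DecidableEq α]

/-- In contrapositive form: a set meeting the whole center family in $t$ points satisfies $|A \cap
Y| \ge t+r$ or $|A \cap V| \ge |V|-s+t$. The bad $S$ contains $s+1-t$ points outside $A$, at least
$r+1$ of them in $Y$, and is filled up from $Y$ first. -/
theorem exists_bad_set {s t r : ℕ} {V Y A : Finset α} (hYV : Y ⊆ V)
    (hY : Y.card = t + 2 * r) (hr : t + r ≤ s) (hsV : s ≤ V.card) (ht : 1 ≤ t)
    (hAV : s + 1 ≤ (V \ A).card + t) (hAY : r + 1 ≤ (Y \ A).card) :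
    ∃ S ⊆ V, S.card = s ∧ t + r ≤ (S ∩ Y).card ∧ (S ∩ A).card < t := by
  obtain ⟨D₁, hD₁, hD₁c⟩ := exists_subset_card_eq hAY
  obtain ⟨D, hD1, hD2, hDc⟩ := exists_subsuperset_card_eq (s := D₁) (t := V \ A)
    (n := s + 1 - t) (hD₁.trans (sdiff_subset_sdiff hYV le_rfl)) (by omega) (by omega)
  have hDV : D ⊆ V := hD2.trans sdiff_subset
  have hDY : r + 1 ≤ (D ∩ Y).card := by
    rw [← hD₁c]
    exact card_le_card fun z hz => mem_inter.2 ⟨hD1 hz, (mem_sdiff.1 (hD₁ hz)).1⟩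
  have hfin : ∀ S : Finset α, D ⊆ S → S.card = s → (S ∩ A).card < t := by
    intro S hDS hSc
    have h1 := card_inter_add_card_sdiff S A
    have h2 : D.card ≤ (S \ A).card := card_le_card fun z hz =>
      mem_sdiff.2 ⟨hDS hz, (mem_sdiff.1 (hD2 hz)).2⟩
    omega
  by_cases hc : s ≤ (D ∪ Y).card
  · obtain ⟨S, hS1, hS2, hSc⟩ := exists_subsuperset_card_eq (s := D) (t := D ∪ Y)
      (n := s) subset_union_left (by omega) hc
    refine ⟨S, hS2.trans (union_subset hDV hYV), hSc, ?_, hfin S hS1 hSc⟩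
    have h1 := card_inter_add_card_sdiff S Y
    have h2 : (S \ Y).card ≤ (D \ Y).card := card_le_card fun z hz => by
      have := @hS2 z
      simp only [mem_sdiff, mem_union] at hz this ⊢
      tauto
    have h3 := card_inter_add_card_sdiff D Y
    omega
  · obtain ⟨S, hS1, hS2, hSc⟩ := exists_subsuperset_card_eq (s := D ∪ Y) (t := V)
      (n := s) (union_subset hDV hYV) (by omega) hsV
    refine ⟨S, hS2, hSc, ?_, hfin S (subset_union_left.trans hS1) hSc⟩
    rw [inter_eq_right.2 (subset_union_right.trans hS1)]
    omega

/-- Identifies the union of the center family: it contains $Y$, and all of $V$ once $t+r < s$. This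
is why $\mathcal B_i$ is a single set except for $i = s-t$. -/
theorem exists_mem_center {s t r : ℕ} {V Y : Finset α} (hYV : Y ⊆ V)
    (hY : Y.card = t + 2 * r) (hr : t + r ≤ s) (hsV : s ≤ V.card) {x : α} (ht : 1 ≤ t)
    (hx : x ∈ Y ∨ x ∈ V ∧ t + r < s) :
    ∃ S ⊆ V, S.card = s ∧ t + r ≤ (S ∩ Y).card ∧ x ∈ S := by
  obtain ⟨P, hP, hPc, hPx⟩ : ∃ P ⊆ Y, P.card = t + r ∧ (x ∈ P ∨ x ∈ V ∧ t + r < s) := by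
    rcases hx with h | h
    · obtain ⟨P, hP1, hP2, hPc⟩ := exists_subsuperset_card_eq (s := {x}) (t := Y) (n := t + r)
        (singleton_subset_iff.2 h) (by rw [card_singleton]; omega) (by omega)
      exact ⟨P, hP2, hPc, Or.inl (hP1 (mem_singleton_self x))⟩
    · obtain ⟨P, hP, hPc⟩ := exists_subset_card_eq (s := Y) (n := t + r) (by omega)
      exact ⟨P, hP, hPc, Or.inr h⟩
  have hxV : x ∈ V := by
    rcases hPx with h | h
    · exact hYV (hP h)
    · exact h.1
  have hle : (insert x P).card ≤ s := by
    rcases hPx with h | h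
    · rw [insert_eq_of_mem h]; omega
    · have := card_insert_le x P
      omega
  obtain ⟨S, hS1, hS2, hSc⟩ := exists_subsuperset_card_eq (s := insert x P) (t := V) (n := s)
    (insert_subset hxV (hP.trans hYV)) hle hsV
  refine ⟨S, hS2, hSc, ?_, hS1 (mem_insert_self _ _)⟩
  rw [← hPc]
  exact card_le_card fun z hz => mem_inter.2 ⟨hS1 (mem_insert_of_mem hz), hP hz⟩

end Center

/-! ### The constructions are admissible -/

section Families

variable {n k s t i : ℕ}

theorem card_initSeg {m : ℕ} (h : m ≤ n) : (initSeg n m).card = m := by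
  have : initSeg n m = univ.filter (fun x : Fin n => x.val < m) := rfl
  rw [this, Fin.card_filter_val_lt]
  omega

theorem initSeg_subset {m m' : ℕ} (h : m ≤ m') : initSeg n m ⊆ initSeg n m' := by
  intro x hx
  simp only [initSeg, mem_filter, mem_univ, true_and] at hx ⊢
  omega

theorem mem_familyA_of_lt (hi : i < s - t) (hts : t + 2 * i ≤ k) (hst : s ≤ k - s + t)
    {A : Finset (Fin n)} :
    A ∈ familyA n k s t i ↔ A.card = k ∧ s ≤ (A ∩ initSeg n k).card ∧
      (t + i ≤ (A ∩ initSeg n (t + 2 * i)).card ∨ k - s + t ≤ (A ∩ initSeg n k).card) := by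
  have h : A ∩ initSeg n k ∩ initSeg n (t + 2 * i) = A ∩ initSeg n (t + 2 * i) := by
    rw [inter_assoc, inter_eq_right.2 (initSeg_subset hts)]
  unfold familyA familyM
  rw [if_pos hi]
  simp only [mem_filter, mem_powersetCard, subset_univ, true_and, mem_union, mem_powerset,
    inter_subset_right, h]
  refine and_congr_right fun _ => ⟨?_, ?_⟩
  · rintro (⟨h1, h2⟩ | h1)
    · exact ⟨h1, Or.inl h2⟩
    · exact ⟨by omega, Or.inr h1⟩
  · rintro ⟨h1, h2 | h2⟩
    · exact Or.inl ⟨h1, h2⟩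
    · exact Or.inr h2

theorem mem_familyA_last {A : Finset (Fin n)} :
    A ∈ familyA n k s t (s - t) ↔ A.card = k ∧ s ≤ (A ∩ initSeg n (2 * s - t)).card := by
  unfold familyA
  rw [if_neg (lt_irrefl _)]
  simp [mem_powersetCard]

theorem mem_familyB_of_lt (hi : i < s - t) {B : Finset (Fin n)} :
    B ∈ familyB n k s t i ↔ B = initSeg n k := by
  unfold familyB
  rw [if_pos hi, mem_singleton]

theorem mem_familyB_last {B : Finset (Fin n)} :
    B ∈ familyB n k s t (s - t) ↔ B.card = k ∧ initSeg n (2 * s - t) ⊆ B := by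
  unfold familyB
  rw [if_neg (lt_irrefl _)]
  simp [mem_powersetCard]

theorem admissiblePair_family (hts : t < s) (hsk : s < k) (hk : 2 * s - t ≤ k)
    (hn : k ≤ n) (hi : i ≤ s - t) : AdmissiblePair k s t (familyA n k s t i) (familyB n k s t i) := by
  have hV := card_initSeg hn
  have hY := card_initSeg (hk.trans hn)
  have hYV := initSeg_subset (n := n) hk
  rcases hi.eq_or_lt with rfl | hi
  · refine ⟨fun A hA => (mem_familyA_last.1 hA).1, fun B hB => (mem_familyB_last.1 hB).1,
      ⟨initSeg n k, mem_familyA_last.2 ⟨hV, ?_⟩⟩, ⟨initSeg n k, mem_familyB_last.2 ⟨hV, hYV⟩⟩,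
      ?_, ?_, ?_⟩
    · rw [inter_eq_right.2 hYV]; omega
    · intro A hA B hB
      exact le_card_inter_of_center (r := s - t) (Y := initSeg n (2 * s - t)) (by omega)
        (by have := (mem_familyA_last.1 hA).2; omega) (by have := (mem_familyA_last.1 hB).2; omega)
    · intro A hA B hB
      have h : initSeg n (2 * s - t) ⊆ A ∩ B :=
        subset_inter (mem_familyB_last.1 hA).2 (mem_familyB_last.1 hB).2
      have := card_le_card h
      omega
    · intro A hA B hB
      exact (mem_familyA_last.1 hA).2.trans
        (card_le_card (inter_subset_inter_left (mem_familyB_last.1 hB).2))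
  · have hmem := fun A => @mem_familyA_of_lt n k s t i hi (by omega) (by omega) A
    refine ⟨fun A hA => ((hmem A).1 hA).1, fun B hB => ?_,
      ⟨initSeg n k, (hmem _).2 ⟨hV, ?_, Or.inr ?_⟩⟩, ⟨initSeg n k, (mem_familyB_of_lt hi).2 rfl⟩,
      ?_, ?_, ?_⟩
    · rw [(mem_familyB_of_lt hi).1 hB, hV]
    · rw [inter_self]; omega
    · rw [inter_self]; omega
    · intro A hA B hB
      obtain ⟨-, h1, h2⟩ := (hmem A).1 hA
      obtain ⟨-, h3, h4⟩ := (hmem B).1 hB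
      -- Inside `[k]`, sets of sizes at least `k - s + t` and `s` overlap in at least `t` points.
      have hbig : k - s + t ≤ (A ∩ initSeg n k).card ∨ k - s + t ≤ (B ∩ initSeg n k).card →
          t ≤ (A ∩ B).card := by
        intro h
        have h5 := card_union_add_card_inter (A ∩ initSeg n k) (B ∩ initSeg n k)
        have h6 : ((A ∩ initSeg n k) ∪ (B ∩ initSeg n k)).card ≤ (initSeg n k).card :=
          card_le_card (union_subset inter_subset_right inter_subset_right)
        have h7 : ((A ∩ initSeg n k) ∩ (B ∩ initSeg n k)).card ≤ (A ∩ B).card :=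
          card_le_card (inter_subset_inter inter_subset_left inter_subset_left)
        omega
      rcases h2 with h2 | h2
      · rcases h4 with h4 | h4
        · exact le_card_inter_of_center (r := i) (card_initSeg (by omega)) h2 h4
        · exact hbig (Or.inr h4)
      · exact hbig (Or.inl h2)
    · intro A hA B hB
      rw [(mem_familyB_of_lt hi).1 hA, (mem_familyB_of_lt hi).1 hB, inter_self]
      omega
    · intro A hA B hB
      rw [(mem_familyB_of_lt hi).1 hB]
      exact ((hmem A).1 hA).2.1

theorem card_family_le_maxConstruction (hi : i ≤ s - t) :
    (familyA n k s t i).card + (familyB n k s t i).card ≤ maxConstruction n k s t :=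
  le_sup (f := fun i => (familyA n k s t i).card + (familyB n k s t i).card)
    (mem_range.2 (by omega))

theorem exists_card_family_eq (n k s t : ℕ) : ∃ i ≤ s - t,
    (familyA n k s t i).card + (familyB n k s t i).card = maxConstruction n k s t := by
  obtain ⟨i, hi, h⟩ := exists_mem_eq_sup (range (s - t + 1)) ⟨0, by simp⟩
    (fun i => (familyA n k s t i).card + (familyB n k s t i).card)
  exact ⟨i, by have := mem_range.1 hi; omega, h.symm⟩

theorem card_permFamily (σ : Equiv.Perm (Fin n)) (F : Finset (Finset (Fin n))) :
    (permFamily σ F).card = F.card :=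
  card_image_of_injective _ (image_injective σ.injective)

theorem card_image_inter_image (σ : Equiv.Perm (Fin n)) (A B : Finset (Fin n)) :
    (A.image σ ∩ B.image σ).card = (A ∩ B).card := by
  rw [← image_inter _ _ σ.injective, card_image_of_injective _ σ.injective]

theorem admissiblePair_symm {F G : Finset (Finset (Fin n))} (h : AdmissiblePair k s t F G) :
    AdmissiblePair k s t G F :=
  ⟨h.right_uniform, h.left_uniform, h.right_nonempty, h.left_nonempty, h.right_intersecting,
    h.left_intersecting, fun A hA B hB => by
      rw [inter_comm]; exact h.cross_intersecting B hB A hA⟩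

theorem admissiblePair_of_perm {F G : Finset (Finset (Fin n))} {σ : Equiv.Perm (Fin n)}
    (h : AdmissiblePair k s t (permFamily σ F) (permFamily σ G)) : AdmissiblePair k s t F G := by
  have hm : ∀ {F : Finset (Finset (Fin n))} {A}, A ∈ F → A.image σ ∈ permFamily σ F :=
    fun hA => mem_image_of_mem _ hA
  refine ⟨fun A hA => ?_, fun B hB => ?_, image_nonempty.1 h.left_nonempty,
    image_nonempty.1 h.right_nonempty, fun A hA B hB => ?_, fun A hA B hB => ?_,
    fun A hA B hB => ?_⟩
  · rw [← card_image_of_injective A σ.injective]; exact h.left_uniform _ (hm hA)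
  · rw [← card_image_of_injective B σ.injective]; exact h.right_uniform _ (hm hB)
  · rw [← card_image_inter_image σ]; exact h.left_intersecting _ (hm hA) _ (hm hB)
  · rw [← card_image_inter_image σ]; exact h.right_intersecting _ (hm hA) _ (hm hB)
  · rw [← card_image_inter_image σ]; exact h.cross_intersecting _ (hm hA) _ (hm hB)

end Families

/-! ### Large pairs lie in a construction -/

section Extremal

variable {n k s t : ℕ}

theorem exists_embedding_map (hn : k ≤ n) {Y : Finset (Fin k)} {Y' V' : Finset (Fin n)}
    (hYV : Y' ⊆ V') (hY : Y'.card = Y.card) (hV : V'.card = k) :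
    ∃ g : Fin k ↪ Fin n, Y.map g = Y' ∧ univ.map g = V' := by
  obtain ⟨σ, h1, h2⟩ := exists_perm_image (Y := Y.map (Fin.castLEEmb hn))
    (B := univ.map (Fin.castLEEmb hn)) (Y' := Y') (B' := V')
    (map_subset_map.2 (subset_univ _)) hYV (by rw [card_map, hY])
    (by rw [card_map, card_univ, Fintype.card_fin, hV])
  refine ⟨(Fin.castLEEmb hn).trans σ.toEmbedding, ?_, ?_⟩
  · rw [← map_map, ← h1, map_eq_image]; rfl
  · rw [← map_map, ← h2, map_eq_image]; rfl

/-- If `F` meets every set of the family centered at `Y` in `t` elements, and `G` contains all of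
them, then `(F, G)` lies in one of the extremal pairs up to a permutation. -/
theorem exists_perm_subset_family {F G : Finset (Finset (Fin n))} (hadm : AdmissiblePair k s t F G)
    (ht : 1 ≤ t) (hts : t < s) (hsk : s < k) (hk : 2 * s - t ≤ k) (hn : k ≤ n)
    {r : ℕ} (hr : t + r ≤ s) {B₀ Y : Finset (Fin n)} (hB₀ : B₀ ∈ G) (hYB : Y ⊆ B₀)
    (hY : Y.card = t + 2 * r)
    (hG : ∀ S ⊆ B₀, S.card = s → t + r ≤ (S ∩ Y).card → ∀ B ∈ G, S ⊆ B)
    (hF : ∀ S ⊆ B₀, S.card = s → t + r ≤ (S ∩ Y).card → ∀ A ∈ F, t ≤ (S ∩ A).card) :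
    ∃ σ : Equiv.Perm (Fin n),
      permFamily σ F ⊆ familyA n k s t r ∧ permFamily σ G ⊆ familyB n k s t r := by
  have hB₀k := hadm.right_uniform B₀ hB₀
  obtain ⟨σ, hσY, hσB⟩ := exists_perm_image (Y := Y) (B := B₀) (Y' := initSeg n (t + 2 * r))
    (B' := initSeg n k) hYB (initSeg_subset (by omega)) (by rw [hY, card_initSeg (by omega)])
    (by rw [hB₀k, card_initSeg hn])
  have hYG : ∀ B ∈ G, Y ⊆ B := by
    intro B hB x hx
    obtain ⟨S, hSB, hSc, hSY, hxS⟩ := exists_mem_center hYB hY hr (by omega) ht (Or.inl hx)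
    exact hG S hSB hSc hSY B hB hxS
  refine ⟨σ, fun A' hA' => ?_, fun B' hB' => ?_⟩
  · obtain ⟨A, hA, rfl⟩ := mem_image.1 hA'
    have hAk : (A.image σ).card = k := by
      rw [card_image_of_injective _ σ.injective, hadm.left_uniform A hA]
    have hno : ¬ (s + 1 ≤ (B₀ \ A).card + t ∧ r + 1 ≤ (Y \ A).card) := by
      rintro ⟨h1, h2⟩
      obtain ⟨S, hS, hSc, hSY, hSA⟩ := exists_bad_set hYB hY hr (by omega) ht h1 h2
      have := hF S hS hSc hSY A hA
      omega
    have h1 := card_inter_add_card_sdiff Y A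
    have h2 := card_inter_add_card_sdiff B₀ A
    rw [inter_comm] at h1 h2
    have h3 : (Y \ A).card ≤ (B₀ \ A).card := card_le_card (sdiff_subset_sdiff hYB le_rfl)
    -- For `r = s - t` the alternative `|B₀ \ A| ≤ s - t` already gives `|Y \ A| ≤ r`, so only the
    -- condition on `Y` remains.
    rcases (show r ≤ s - t by omega).eq_or_lt with hrs | hrs
    · rw [hrs, mem_familyA_last]
      refine ⟨hAk, ?_⟩
      rw [show 2 * s - t = t + 2 * r by omega, ← hσY, card_image_inter_image]
      omega
    · rw [mem_familyA_of_lt hrs (by omega) (by omega), ← hσY, ← hσB, card_image_inter_image,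
        card_image_inter_image]
      refine ⟨hAk, hadm.cross_intersecting A hA B₀ hB₀, ?_⟩
      omega
  · obtain ⟨B, hB, rfl⟩ := mem_image.1 hB'
    rcases (show r ≤ s - t by omega).eq_or_lt with hrs | hrs
    · rw [hrs, mem_familyB_last, show 2 * s - t = t + 2 * r by omega, ← hσY]
      refine ⟨?_, image_subset_image (hYG B hB)⟩
      rw [card_image_of_injective _ σ.injective, hadm.right_uniform B hB]
    · rw [mem_familyB_of_lt hrs, ← hσB]
      have hsub : B₀ ⊆ B := by
        intro x hx
        obtain ⟨S, hSB, hSc, hSY, hxS⟩ :=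
          exists_mem_center hYB hY hr (by omega) ht (Or.inr ⟨hx, by omega⟩)
        exact hG S hSB hSc hSY B hB hxS
      rw [eq_of_subset_of_card_le hsub (by rw [hadm.right_uniform B hB, hB₀k])]

/-- The `s`-subsets of `[k]` that share at least `t + r` elements with `[t + 2r]`. -/
def initCenter (n k s t r : ℕ) : Finset (Finset (Fin n)) :=
  (powersetCard s (initSeg n k)).filter (fun S => t + r ≤ (S ∩ initSeg n (t + 2 * r)).card)

/-- Supplies the lower bound: only the sets of $\mathcal A_r$ with exactly $s$ points in $[k]$ are
counted, which already gives the main term. -/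
theorem traceFiber_initCenter_subset {r : ℕ} (hts : t < s) (hk : 2 * s - t ≤ k) (hr : t + r ≤ s) :
    traceFiber k (initSeg n k) (initCenter n k s t r) ⊆ familyA n k s t r := by
  intro A hA
  simp only [traceFiber, initCenter, mem_filter, mem_powersetCard, subset_univ, true_and,
    inter_subset_right] at hA
  obtain ⟨hAk, hAs, hAr⟩ := hA
  rw [inter_assoc, inter_eq_right.2 (initSeg_subset (by omega))] at hAr
  rcases (show r ≤ s - t by omega).eq_or_lt with hrs | hrs
  · rw [hrs, mem_familyA_last, show 2 * s - t = t + 2 * r by omega]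
    exact ⟨hAk, by omega⟩
  · rw [mem_familyA_of_lt hrs (by omega) (by omega)]
    exact ⟨hAk, hAs.ge, Or.inl hAr⟩

theorem card_traceFiber_initCenter {r : ℕ} (hsk : s < k) (hn : k ≤ n) :
    (traceFiber k (initSeg n k) (initCenter n k s t r)).card
      = (initCenter n k s t r).card * (n - k).choose (k - s) := by
  have hQ : ∀ E ∈ initCenter n k s t r, E ⊆ initSeg n k ∧ E.card = s := fun E hE =>
    mem_powersetCard.1 (mem_filter.1 hE).1
  rw [card_traceFiber hQ hsk.le, Fintype.card_fin, card_initSeg hn]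

theorem three_le_choose {m s : ℕ} (h : s + 1 ≤ m) (hs : 2 ≤ s) : 3 ≤ m.choose s := by
  have h1 : (s + 1).choose s ≤ m.choose s := Nat.choose_le_choose s h
  rw [Nat.choose_succ_self_right] at h1
  omega

/-- Outside the exceptional case, pairs that are at least as large as the best construction lie in
one of the constructions. -/
theorem exists_perm_subset_of_max_le (ht : 1 ≤ t) (hts : t < s) (hsk : s < k)
    (hk : 2 * s - t ≤ k) (hne : ¬ (k = 2 * s ∧ t = 1)) :
    ∃ n₀, k ≤ n₀ ∧ ∀ n, n₀ ≤ n → ∀ F G : Finset (Finset (Fin n)), AdmissiblePair k s t F G →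
      maxConstruction n k s t ≤ F.card + G.card → ∃ i ≤ s - t, ∃ σ : Equiv.Perm (Fin n),
        permFamily σ F ⊆ familyA n k s t i ∧ permFamily σ G ⊆ familyB n k s t i ∨
        permFamily σ F ⊆ familyB n k s t i ∧ permFamily σ G ⊆ familyA n k s t i := by
  obtain ⟨n₀, hkn₀, hlarge⟩ := exists_main_term_dominates hsk
  refine ⟨n₀, hkn₀, fun n hn F G hadm hmaxle => ?_⟩
  have hkn : k ≤ n := hkn₀.trans hn
  -- `T₀.card` is the number `M` of the outline; its center form gives an index `r₀` whose
  -- construction attains the main term.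
  obtain ⟨T₀, hT₀⟩ := exists_isMaxTInt (α := Fin k) s t
  have hcf : Fintype.card (Fin k) = k := Fintype.card_fin k
  obtain ⟨r₀, Y₀, hr₀, hY₀, hT₀Y⟩ := exists_eq_centerFamily hT₀ ht hts.le (by omega)
    (by rw [hcf]; exact hne)
  -- All `s`-subsets of a set of size `2 * s - t ≥ s + 1` form a `t`-intersecting family.
  have hM3 : 3 ≤ T₀.card := by
    obtain ⟨Y, -, hY⟩ := exists_subset_card_eq (s := (univ : Finset (Fin k))) (n := 2 * s - t)
      (by rw [card_univ, hcf]; exact hk)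
    refine (three_le_choose (m := 2 * s - t) (s := s) (by omega) (by omega)).trans ?_
    rw [← hY, ← card_powersetCard]
    refine hT₀.le_card _ (fun A hA => (mem_powersetCard.1 hA).2) fun A hA B hB => ?_
    obtain ⟨hAY, hAs⟩ := mem_powersetCard.1 hA
    obtain ⟨hBY, hBs⟩ := mem_powersetCard.1 hB
    refine le_card_inter_of_center (r := s - t) (Y := Y) (by omega) ?_ ?_
    · rw [inter_eq_left.2 hAY]; omega
    · rw [inter_eq_left.2 hBY]; omega
  have hMk : T₀.card ≤ k.choose s := by
    have h := card_le_card (s := T₀) (t := powersetCard s univ) fun A hA =>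
      mem_powersetCard.2 ⟨subset_univ _, hT₀.sized A hA⟩
    rwa [card_powersetCard, card_univ, hcf] at h
  have hM0 : T₀.card ≤ (initCenter n k s t r₀).card := by
    obtain ⟨g, hg1, hg2⟩ := exists_embedding_map hkn (Y := Y₀) (Y' := initSeg n (t + 2 * r₀))
      (V' := initSeg n k) (initSeg_subset (by omega)) (by rw [hY₀, card_initSeg (by omega)])
      (card_initSeg hkn)
    rw [← card_lift g]
    refine card_le_card fun S hS => ?_
    obtain ⟨A, hA, rfl⟩ := mem_image.1 hS
    rw [hT₀Y] at hA
    obtain ⟨hA1, hA2⟩ := mem_centerFamily.1 hA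
    refine mem_filter.2 ⟨mem_powersetCard.2 ⟨?_, by rw [card_map, hA1]⟩, ?_⟩
    · rw [← hg2]; exact map_subset_map.2 (subset_univ _)
    · rw [← hg1, card_map_inter_map]; exact hA2
  have hlow : T₀.card * (n - k).choose (k - s) ≤ F.card + G.card := by
    refine (Nat.mul_le_mul_right _ hM0).trans ?_
    rw [← card_traceFiber_initCenter hsk hkn]
    refine (card_le_card (traceFiber_initCenter_subset hts hk hr₀)).trans ?_
    exact (Nat.le_add_right _ _).trans
      ((card_family_le_maxConstruction (by omega)).trans hmaxle)
  have hone : ∀ F G : Finset (Finset (Fin n)), AdmissiblePair k s t F G →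
      T₀.card ≤ (heavy k s F).card → ∃ i ≤ s - t, ∃ σ : Equiv.Perm (Fin n),
        permFamily σ F ⊆ familyA n k s t i ∧ permFamily σ G ⊆ familyB n k s t i := by
    intro F G hadm hle
    obtain ⟨B₀, hB₀⟩ := hadm.right_nonempty
    have hB₀k := hadm.right_uniform B₀ hB₀
    obtain ⟨hTF, hTt⟩ := tInt_heavy hadm.left_uniform hsk hadm.left_intersecting
    have hTG := subset_of_heavy hadm.left_uniform hadm.right_uniform hsk hadm.cross_intersecting
    obtain ⟨g, -, hg⟩ := exists_embedding_map hkn (Y := ∅) (Y' := ∅) (empty_subset B₀) rfl hB₀k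
    obtain ⟨r, Y, hr, hYB, hY, hT⟩ := exists_center_on hg hT₀
      (fun S hS => mem_powersetCard.2 ⟨hTG S hS B₀ hB₀, card_of_mem_heavy hS⟩) hTt hle ht hts.le
      (by omega) (by rw [hcf]; exact hne)
    have hmem : ∀ S ⊆ B₀, S.card = s → t + r ≤ (S ∩ Y).card → S ∈ heavy k s F := by
      intro S h1 h2 h3
      rw [hT]
      exact mem_filter.2 ⟨mem_powersetCard.2 ⟨h1, h2⟩, h3⟩
    exact ⟨r, by omega, exists_perm_subset_family hadm ht hts hsk hk hkn hr hB₀ hYB hY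
      (fun S h1 h2 h3 => hTG S (hmem S h1 h2 h3)) fun S h1 h2 h3 => hTF S (hmem S h1 h2 h3)⟩
  have hnf : Fintype.card (Fin n) = n := Fintype.card_fin n
  rcases le_card_heavy_or hadm.left_uniform hadm.right_uniform hadm.left_nonempty
    hadm.right_nonempty hsk hadm.cross_intersecting hM3
    (by rw [hnf]; exact hlarge n hn _ (by omega) hMk) (by rw [hnf]; exact hlow) with h | h
  · obtain ⟨i, hi, σ, h1, h2⟩ := hone F G hadm h
    exact ⟨i, hi, σ, Or.inl ⟨h1, h2⟩⟩
  · obtain ⟨i, hi, σ, h1, h2⟩ := hone G F (admissiblePair_symm hadm) h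
    exact ⟨i, hi, σ, Or.inr ⟨h2, h1⟩⟩

/-! ### The exceptional case: intersecting families and complementary pairs -/

section Half

variable {α : Type*} [DecidableEq α]

theorem card_sdiff_image {V : Finset α} {T : Finset (Finset α)} (hT : T ⊆ powersetCard s V) :
    (T.image (V \ ·)).card = T.card := by
  refine card_image_of_injOn fun A hA B hB h => ?_
  have h1 := (mem_powersetCard.1 (hT hA)).1
  have h2 := (mem_powersetCard.1 (hT hB)).1
  rw [← Finset.sdiff_sdiff_eq_self h1, ← Finset.sdiff_sdiff_eq_self h2]
  exact congrArg (V \ ·) h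

theorem two_mul_card_le {V : Finset α} {T : Finset (Finset α)} (hV : V.card = 2 * s)
    (hT : T ⊆ powersetCard s V) (hTc : ∀ S ∈ T, V \ S ∉ T) :
    2 * T.card ≤ (2 * s).choose s := by
  have hdisj : Disjoint T (T.image (V \ ·)) := by
    rw [disjoint_left]
    intro S hS hS'
    obtain ⟨S₁, hS₁, rfl⟩ := mem_image.1 hS'
    exact hTc S₁ hS₁ hS
  rw [← hV, ← card_powersetCard]
  calc 2 * T.card = (T ∪ T.image (V \ ·)).card := by
        rw [card_union_of_disjoint hdisj, card_sdiff_image hT, two_mul]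
    _ ≤ _ := card_le_card (union_subset hT fun S hS => by
        obtain ⟨S₁, hS₁, rfl⟩ := mem_image.1 hS
        obtain ⟨h1, h2⟩ := mem_powersetCard.1 (hT hS₁)
        refine mem_powersetCard.2 ⟨sdiff_subset, ?_⟩
        rw [card_sdiff_of_subset h1]
        omega)

theorem le_two_mul_card {V : Finset α} {T : Finset (Finset α)} (hV : V.card = 2 * s)
    (hT : T ⊆ powersetCard s V) (hTc : ∀ S ∈ powersetCard s V, S ∈ T ∨ V \ S ∈ T) :
    (2 * s).choose s ≤ 2 * T.card := by
  rw [← hV, ← card_powersetCard, two_mul]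
  nth_rewrite 2 [← card_sdiff_image hT]
  refine le_trans (card_le_card fun S hS => ?_) (card_union_le _ _)
  rcases hTc S hS with h | h
  · exact mem_union_left _ h
  · exact mem_union_right _ (mem_image.2 ⟨_, h, Finset.sdiff_sdiff_eq_self (mem_powersetCard.1 hS).1⟩)

end Half

theorem two_mul_card_initCenter (hs : 1 ≤ s) (hn : 2 * s ≤ n) :
    (2 * s).choose s ≤ 2 * (initCenter n (2 * s) s 1 0).card := by
  refine le_two_mul_card (card_initSeg hn) (filter_subset _ _) fun S hS => ?_
  obtain ⟨hSV, hSs⟩ := mem_powersetCard.1 hS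
  have hx : (⟨0, by omega⟩ : Fin n) ∈ initSeg n 1 := by simp [initSeg]
  have hxV : (⟨0, by omega⟩ : Fin n) ∈ initSeg n (2 * s) := initSeg_subset (by omega) hx
  have hmem : ∀ S : Finset (Fin n), (⟨0, by omega⟩ : Fin n) ∈ S → S ⊆ initSeg n (2 * s) →
      S.card = s → S ∈ initCenter n (2 * s) s 1 0 := fun S h0 h1 h2 =>
    mem_filter.2 ⟨mem_powersetCard.2 ⟨h1, h2⟩, card_pos.2 ⟨_, mem_inter.2 ⟨h0, hx⟩⟩⟩
  by_cases h0 : (⟨0, by omega⟩ : Fin n) ∈ S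
  · exact Or.inl (hmem S h0 hSV hSs)
  · refine Or.inr (hmem _ (mem_sdiff.2 ⟨hxV, h0⟩) sdiff_subset ?_)
    rw [card_sdiff_of_subset hSV, card_initSeg hn]
    omega

theorem card_centerFamily_le {c : ℕ} {B B' : Finset (Fin n)} (h : B.card = B'.card) :
    (centerFamily k c B).card ≤ (centerFamily k c B').card := by
  obtain ⟨σ, -, hσ⟩ := exists_perm_image (Y := B) (B := B) (Y' := B') (B' := B') Subset.rfl
    Subset.rfl h h
  rw [← card_permFamily σ]
  refine card_le_card fun A' hA' => ?_
  obtain ⟨A, hA, rfl⟩ := mem_image.1 hA'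
  obtain ⟨h1, h2⟩ := mem_centerFamily.1 hA
  rw [mem_centerFamily, card_image_of_injective _ σ.injective, ← hσ, card_image_inter_image]
  exact ⟨h1, h2⟩

/-- The upper bound in the exceptional case `k = 2s`, `t = 1`. -/
theorem card_le_maxConstruction_of_half (hs : 2 ≤ s) :
    ∃ n₀, 2 * s ≤ n₀ ∧ ∀ n, n₀ ≤ n → ∀ F G : Finset (Finset (Fin n)),
      AdmissiblePair (2 * s) s 1 F G →
        F.card + G.card ≤ maxConstruction n (2 * s) s 1 := by
  obtain ⟨n₀, hkn₀, hlarge⟩ := exists_main_term_dominates (k := 2 * s) (s := s) (by omega)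
  refine ⟨n₀, hkn₀, fun n hn F G hadm => ?_⟩
  by_contra hlt
  have hkn : 2 * s ≤ n := hkn₀.trans hn
  obtain ⟨m, hm⟩ : ∃ m, 2 * s = m + 1 := ⟨2 * s - 1, by omega⟩
  have hM : (2 * s).choose s = 2 * m.choose s := by
    obtain ⟨u, rfl⟩ : ∃ u, s = u + 1 := ⟨s - 1, by omega⟩
    have h1 : m.choose u = m.choose (u + 1) := Nat.choose_symm_of_eq_add (by omega)
    rw [hm, Nat.choose_succ_succ', h1, two_mul]
  have hinit := two_mul_card_initCenter (s := s) (by omega) hkn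
  have hinit' : m.choose s ≤ (initCenter n (2 * s) s 1 0).card := by omega
  have hfib := card_traceFiber_initCenter (n := n) (k := 2 * s) (s := s) (t := 1) (r := 0)
    (by omega) hkn
  have hlow : m.choose s * (n - 2 * s).choose (2 * s - s) ≤ F.card + G.card := by
    refine (Nat.mul_le_mul_right _ hinit').trans ?_
    rw [← hfib]
    refine (card_le_card (traceFiber_initCenter_subset (by omega) (by omega) (by omega))).trans ?_
    exact (Nat.le_add_right _ _).trans
      ((card_family_le_maxConstruction (Nat.zero_le _)).trans (not_le.1 hlt).le)
  have hone : ∀ F G : Finset (Finset (Fin n)), AdmissiblePair (2 * s) s 1 F G →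
      m.choose s ≤ (heavy (2 * s) s F).card →
        F.card + G.card ≤ maxConstruction n (2 * s) s 1 := by
    intro F G hadm hle
    have hsk : s < 2 * s := by omega
    obtain ⟨B₀, hB₀⟩ := hadm.right_nonempty
    have hB₀k := hadm.right_uniform B₀ hB₀
    obtain ⟨hTF, hTt⟩ := tInt_heavy hadm.left_uniform hsk hadm.left_intersecting
    have hTG := subset_of_heavy hadm.left_uniform hadm.right_uniform hsk hadm.cross_intersecting
    have hTB : heavy (2 * s) s F ⊆ powersetCard s B₀ := fun S hS =>
      mem_powersetCard.2 ⟨hTG S hS B₀ hB₀, card_of_mem_heavy hS⟩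
    have hTc : ∀ S ∈ heavy (2 * s) s F, B₀ \ S ∉ heavy (2 * s) s F := by
      intro S hS hS'
      have := hTt S hS _ hS'
      rw [disjoint_iff_inter_eq_empty.1 disjoint_sdiff, card_empty] at this
      omega
    have hThalf := two_mul_card_le hB₀k hTB hTc
    have hTcard : (heavy (2 * s) s F).card = m.choose s := by omega
    -- The heavy sets contain exactly one of each complementary pair in `B₀` but need not have a
    -- center. If `G = {B₀}`, only the number of admissible traces of size `s` matters, and it is
    -- the same as for `familyA` with index `0`.
    by_cases hG : ∀ B ∈ G, B = B₀
    · have hGc : G.card = 1 := card_eq_one.2 ⟨B₀, eq_singleton_iff_unique_mem.2 ⟨hB₀, hG⟩⟩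
      have hBc : (familyB n (2 * s) s 1 0).card = 1 := card_eq_one.2
        ⟨initSeg n (2 * s), eq_singleton_iff_unique_mem.2
          ⟨(mem_familyB_of_lt (by omega)).2 rfl, fun B hB => (mem_familyB_of_lt (by omega)).1 hB⟩⟩
      -- A trace of size `s` on `B₀` cannot be the complement of a heavy set, since heavy sets meet
      -- every member of `F`.
      have hFsub : F ⊆ traceFiber (2 * s) B₀ (powersetCard s B₀ \
          (heavy (2 * s) s F).image (B₀ \ ·)) ∪ centerFamily (2 * s) (s + 1) B₀ := by
        intro A hA
        have hAk := hadm.left_uniform A hA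
        have hAB := hadm.cross_intersecting A hA B₀ hB₀
        rcases hAB.eq_or_lt with h | h
        · refine mem_union_left _ (mem_filter.2
            ⟨mem_powersetCard.2 ⟨subset_univ _, hAk⟩, mem_sdiff.2
              ⟨mem_powersetCard.2 ⟨inter_subset_right, h.symm⟩, fun hc => ?_⟩⟩)
          obtain ⟨S, hS, hSA⟩ := mem_image.1 hc
          have h1 := hTF S hS A hA
          have h2 : S ∩ A = ∅ := by
            rw [← disjoint_iff_inter_eq_empty, disjoint_left]
            intro z hz hzA
            have : z ∈ B₀ \ S := by
              rw [hSA]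
              exact mem_inter.2 ⟨hzA, (mem_powersetCard.1 (hTB hS)).1 hz⟩
            exact (mem_sdiff.1 this).2 hz
          rw [h2, card_empty] at h1
          omega
        · exact mem_union_right _ (mem_centerFamily.2 ⟨hAk, h⟩)
      have himg : (heavy (2 * s) s F).image (B₀ \ ·) ⊆ powersetCard s B₀ := fun S hS => by
        obtain ⟨S₁, hS₁, rfl⟩ := mem_image.1 hS
        obtain ⟨h1, h2⟩ := mem_powersetCard.1 (hTB hS₁)
        refine mem_powersetCard.2 ⟨sdiff_subset, ?_⟩
        rw [card_sdiff_of_subset h1]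
        omega
      have hF1 : (traceFiber (2 * s) B₀ (powersetCard s B₀ \
          (heavy (2 * s) s F).image (B₀ \ ·))).card
            = m.choose s * (n - 2 * s).choose (2 * s - s) := by
        rw [card_traceFiber (j := s) (fun E hE => mem_powersetCard.1 (mem_sdiff.1 hE).1) hsk.le,
          Fintype.card_fin, hB₀k, card_sdiff_of_subset himg, card_sdiff_image hTB,
          card_powersetCard, hB₀k, hTcard, hM]
        congr 1
        omega
      have hF2 : (centerFamily (2 * s) (s + 1) B₀).card
          ≤ (centerFamily (2 * s) (s + 1) (initSeg n (2 * s))).card :=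
        card_centerFamily_le (by rw [hB₀k, card_initSeg hkn])
      have hA1 : traceFiber (2 * s) (initSeg n (2 * s)) (initCenter n (2 * s) s 1 0) ∪
          centerFamily (2 * s) (s + 1) (initSeg n (2 * s)) ⊆ familyA n (2 * s) s 1 0 := by
        refine union_subset (traceFiber_initCenter_subset (by omega) (by omega) (by omega)) ?_
        intro A hA
        obtain ⟨h1, h2⟩ := mem_centerFamily.1 hA
        rw [mem_familyA_of_lt (by omega) (by omega) (by omega)]
        exact ⟨h1, by omega, Or.inr (by omega)⟩
      have hdisj : Disjoint (traceFiber (2 * s) (initSeg n (2 * s)) (initCenter n (2 * s) s 1 0))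
          (centerFamily (2 * s) (s + 1) (initSeg n (2 * s))) := by
        rw [disjoint_left]
        intro A hA hA'
        have h1 := (mem_centerFamily.1 hA').2
        have h2 := (mem_powersetCard.1 (mem_filter.1 (mem_filter.1 hA).2).1).2
        omega
      have hA2 := card_le_card hA1
      rw [card_union_of_disjoint hdisj, hfib] at hA2
      have hF3 := (card_le_card hFsub).trans (card_union_le _ _)
      have h6 := Nat.mul_le_mul_right ((n - 2 * s).choose (2 * s - s)) hinit'
      refine le_trans ?_ (card_family_le_maxConstruction (i := 0) (Nat.zero_le _))
      omega
    · push Not at hG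
      obtain ⟨B, hB, hBB⟩ := hG
      have hlt : (B ∩ B₀).card < 2 * s := by
        by_contra hge
        have hBk := hadm.right_uniform B hB
        have h1 := eq_of_subset_of_card_le (inter_subset_left (s₁ := B) (s₂ := B₀)) (by omega)
        exact hBB (eq_of_subset_of_card_le (inter_eq_left.1 h1) (by omega))
      -- A second member of `G` confines the heavy sets to `2 * s - 1` points; by their number they
      -- are all `s`-subsets of `Y`, the center family with `r = s - 1`.
      obtain ⟨Y, hY1, hY2, hYc⟩ := exists_subsuperset_card_eq (s := B ∩ B₀) (t := B₀) (n := m)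
        inter_subset_right (by omega) (by omega)
      have hTY : heavy (2 * s) s F = powersetCard s Y := by
        refine eq_of_subset_of_card_le (fun S hS => mem_powersetCard.2 ⟨?_, card_of_mem_heavy hS⟩)
          (by rw [card_powersetCard, hYc]; exact hle)
        exact (subset_inter (hTG S hS B hB) (hTG S hS B₀ hB₀)).trans hY1
      have hmem : ∀ S ⊆ B₀, S.card = s → 1 + (s - 1) ≤ (S ∩ Y).card → S ∈ heavy (2 * s) s F := by
        intro S _ h2 h3
        rw [hTY, mem_powersetCard]
        refine ⟨inter_eq_left.1 (eq_of_subset_of_card_le inter_subset_left (by omega)), h2⟩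
      obtain ⟨σ, h1, h2⟩ := exists_perm_subset_family hadm le_rfl (by omega) hsk (by omega) hkn
        (r := s - 1) (by omega) hB₀ hY2 (by omega)
        (fun S h1 h2 h3 => hTG S (hmem S h1 h2 h3)) fun S h1 h2 h3 => hTF S (hmem S h1 h2 h3)
      have h3 := card_le_card h1
      have h4 := card_le_card h2
      rw [card_permFamily] at h3 h4
      exact (Nat.add_le_add h3 h4).trans (card_family_le_maxConstruction le_rfl)
  have hnf : Fintype.card (Fin n) = n := Fintype.card_fin n
  have hM3 : 3 ≤ m.choose s := three_le_choose (by omega) hs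
  rcases le_card_heavy_or hadm.left_uniform hadm.right_uniform hadm.left_nonempty
    hadm.right_nonempty (by omega) hadm.cross_intersecting hM3
    (by rw [hnf]; exact hlarge n hn _ (by omega) (by omega)) (by rw [hnf]; exact hlow) with h | h
  · exact hlt (hone F G hadm h)
  · exact hlt (by rw [add_comm]; exact hone G F (admissiblePair_symm hadm) h)

/-- Equality of sizes forces a pair contained in another one to be equal to it. -/
theorem permFamily_eq_of_subset {F G A B : Finset (Finset (Fin n))} {σ : Equiv.Perm (Fin n)}
    (hF : permFamily σ F ⊆ A) (hG : permFamily σ G ⊆ B) (h : A.card + B.card ≤ F.card + G.card) :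
    permFamily σ F = A ∧ permFamily σ G = B := by
  have h1 := card_le_card hF
  have h2 := card_le_card hG
  have h3 := card_permFamily σ F
  have h4 := card_permFamily σ G
  exact ⟨eq_of_subset_of_card_le hF (by omega), eq_of_subset_of_card_le hG (by omega)⟩

end Extremal

end CompleteIntersection

open CompleteIntersection

theorem theorem4 (k s t : ℕ) (ht : 1 ≤ t) (hts : t < s) (hsk : s < k) (hk : 2 * s - t ≤ k) :
    ∃ n₀ : ℕ, ∀ n : ℕ, n₀ ≤ n →
      IsGreatest
        {m : ℕ | ∃ F G : Finset (Finset (Fin n)),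
          AdmissiblePair k s t F G ∧ m = F.card + G.card}
        (maxConstruction n k s t) ∧
      (¬ (k = 2 * s ∧ t = 1) →
        ∀ F G : Finset (Finset (Fin n)),
          (AdmissiblePair k s t F G ∧ F.card + G.card = maxConstruction n k s t) ↔
            ∃ i : ℕ, i ≤ s - t ∧
              (familyA n k s t i).card + (familyB n k s t i).card = maxConstruction n k s t ∧
              PairIsomorphic F G (familyA n k s t i) (familyB n k s t i)) := by
  have hattained : ∀ n, k ≤ n → maxConstruction n k s t ∈
      {m : ℕ | ∃ F G : Finset (Finset (Fin n)),
        AdmissiblePair k s t F G ∧ m = F.card + G.card} := by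
    intro n hn
    obtain ⟨i, hi, h⟩ := exists_card_family_eq n k s t
    exact ⟨_, _, admissiblePair_family hts hsk hk hn hi, h.symm⟩
  by_cases hne : k = 2 * s ∧ t = 1
  · obtain ⟨rfl, rfl⟩ := hne
    obtain ⟨n₀, hkn₀, h₀⟩ := card_le_maxConstruction_of_half (s := s) (by omega)
    refine ⟨n₀, fun n hn => ⟨⟨hattained n (hkn₀.trans hn), ?_⟩, fun h => absurd ⟨rfl, rfl⟩ h⟩⟩
    rintro m ⟨F, G, hadm, rfl⟩
    exact h₀ n hn F G hadm
  · obtain ⟨n₀, hkn₀, h₀⟩ := exists_perm_subset_of_max_le ht hts hsk hk hne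
    refine ⟨n₀, fun n hn => ⟨⟨hattained n (hkn₀.trans hn), ?_⟩, fun _ F G => ⟨?_, ?_⟩⟩⟩
    · rintro m ⟨F, G, hadm, rfl⟩
      by_contra hlt
      obtain ⟨i, hi, σ, h⟩ := h₀ n hn F G hadm (not_le.1 hlt).le
      have hmax := card_family_le_maxConstruction (n := n) (k := k) hi
      have h3 := card_permFamily σ F
      have h4 := card_permFamily σ G
      rcases h with ⟨h1, h2⟩ | ⟨h1, h2⟩
      · have h1 := Finset.card_le_card h1
        have h2 := Finset.card_le_card h2
        omega
      · have h1 := Finset.card_le_card h1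
        have h2 := Finset.card_le_card h2
        omega
    · rintro ⟨hadm, heq⟩
      obtain ⟨i, hi, σ, h⟩ := h₀ n hn F G hadm heq.ge
      have hmax := card_family_le_maxConstruction (n := n) (k := k) hi
      rcases h with ⟨h1, h2⟩ | ⟨h1, h2⟩
      · obtain ⟨e1, e2⟩ := permFamily_eq_of_subset h1 h2 (by omega)
        refine ⟨i, hi, ?_, σ, Or.inl ⟨e1, e2⟩⟩
        rw [← e1, ← e2, card_permFamily, card_permFamily, heq]
      · obtain ⟨e1, e2⟩ := permFamily_eq_of_subset h1 h2 (by omega)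
        refine ⟨i, hi, ?_, σ, Or.inr ⟨e1, e2⟩⟩
        rw [← e1, ← e2, card_permFamily, card_permFamily, add_comm, heq]
    · rintro ⟨i, hi, hcard, σ, h⟩
      have hfam := admissiblePair_family hts hsk hk (hkn₀.trans hn) hi
      have h3 := card_permFamily σ F
      have h4 := card_permFamily σ G
      rcases h with ⟨e1, e2⟩ | ⟨e1, e2⟩
      · refine ⟨admissiblePair_of_perm (σ := σ) (by rw [e1, e2]; exact hfam), ?_⟩
        rw [← h3, ← h4, e1, e2, hcard]
      · refine ⟨admissiblePair_of_perm (σ := σ) (by rw [e1, e2]; exact admissiblePair_symm hfam), ?_⟩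
        rw [← h3, ← h4, e1, e2, add_comm, hcard]
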